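/- Let $\hat A=\{\sum_{\nu\ge 0}P_\nu(a)b^\nu : P_\nu\in\mathbb C[[a]]\}$ be the $\mathbb C$-algebra with $ab-ba=b^2$ in which left and right multiplication by elements of $\mathbb C[[a]]$ is continuous for the $b$-adic filtration. A change of variable is a $\theta\in\mathbb C[[a]]$ with $\theta(0)=0$, $\theta'(0)\neq 0$; put $\alpha=\theta(a)$, $\beta=b\,\theta'(a)$ and $\Theta(\sum P_\nu(a)b^\nu)=\sum P_\nu(\alpha)\beta^\nu$. For a left $\hat A$-module $E$, $\theta_*(E)$ is the same vector space on which $x\in\hat A$ acts as $\Theta(x)$. A simple pole (a,b)-module is an $\hat A$-module $F$, free of finite rank over $\mathbb C[[b]]$, with $aF\subset bF$; an $\hat A$-module is regular if it embeds in a simple pole (a,b)-module. The Bernstein polynomial of a regular $E$ is the minimal polynomial of $-b^{-1}a$ on $E^\sharp/bE^\sharp$, where $E^\sharp$ is the smallest simple pole (a,b)-module containing $E$. A fresco is a regular $E$, generated by one element over $\hat A$, whose Bernstein polynomial has only negative rational roots. Fix a rational $\lambda\in\,]0,1]$ and put $[\lambda]=\lambda+\mathbb Z$; a fresco is $[\lambda]$-primitive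 if these roots all lie in $-[\lambda]$. Let $\Xi_\lambda^{(N)}$ be the free $\mathbb C[[b]]$-module with basis $e_0,\dots,e_N$ and $ae_0=\lambda be_0$, $ae_j=\lambda be_j+be_{j-1}$ for $1\le j\le N$. A $[\lambda]$-primitive fresco $E$ is a theme if it embeds $\hat A$-linearly in some $\Xi_\lambda^{(N)}$, and semi-simple if every $\hat A$-linear map $E\to\Xi_\lambda^{(N)}$, for every $N$, has rank at most $1$ over $\mathbb C[[b]]$. For a $[\lambda]$-primitive fresco $E$, a submodule $F$ is normal if $E/F$ is free over $\mathbb C[[b]]$; $S_1(E)$ is the biggest semi-simple submodule (the sum of all submodules that are semi-simple $[\lambda]$-primitive frescos); $\Sigma^1(E)$ is the smallest normal submodule with semi-simple quotient (the intersection of all such submodules); $d(E)$ is the maximal rank over $\mathbb C[[b]]$ of a normal submodule that is a theme; and $\delta(E)$ is the common value of $\dim_{\mathbb C}\ker(a-\mu b: E\to E)$ for all sufficiently large $\mu\in[\lambda]$. **Statement.** Let $\theta$ be any change of variable. 1. If $E$ is a $[\lambda]$-primitive theme, then so is $\theta_*(E)$. If $E$ is a semi-simple $[\lambda]$-primitive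 fresco, then so is $\theta_*(E)$. 2. If $E$ is a $[\lambda]$-primitive fresco, then so is $\theta_*(E)$, and there are natural $\hat A$-linear isomorphisms $u:\theta_*(S_1(E))\to S_1(\theta_*(E))$ and $v:\Sigma^1(\theta_*(E))\to\theta_*(\Sigma^1(E))$, both induced by the identity of the underlying vector space of $E$. Moreover $d(\theta_*(E))=d(E)$ and $\delta(\theta_*(E))=\delta(E)$. -/

import Mathlib

noncomputable section

open PowerSeries

/-- The algebra `Â` of formal sums `∑ P_ν(a) b^ν`; `x ν` is the coefficient `P_ν ∈ ℂ[[a]]`. -/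
def Ahat : Type := ℕ → PowerSeries ℂ

namespace Ahat

instance : AddCommGroup Ahat := inferInstanceAs (AddCommGroup (ℕ → PowerSeries ℂ))

/-- The coefficient `P_ν(a)` of `b^ν` (powers of `b` on the right). -/
def coeff (x : Ahat) (n : ℕ) : PowerSeries ℂ := x n

@[ext] theorem ext {x y : Ahat} (h : ∀ n, x.coeff n = y.coeff n) : x = y := funext h

@[simp] theorem coeff_add (x y : Ahat) (n : ℕ) : (x + y).coeff n = x.coeff n + y.coeff n := rfl
@[simp] theorem coeff_zero (n : ℕ) : (0 : Ahat).coeff n = 0 := rfl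

/-- `S(a) = S` seen in `Â`. -/
def ofAFun (S : PowerSeries ℂ) : Ahat := fun n => if n = 0 then S else 0

/-- The element `∑ S_ν b^ν` of `Â`. -/
def ofBFun (S : PowerSeries ℂ) : Ahat := fun n => C (PowerSeries.coeff n S)

instance : One Ahat := ⟨ofAFun 1⟩

/-- The product, determined by `b^n T(a) = ∑_k (-1)^k (n+k-1 choose k) T^(k)(a) b^(n+k)`, which is
the expansion forced by `a b - b a = b²` and `b`-adic continuity. -/
instance : Mul Ahat := ⟨fun x y => fun N =>
  ∑ p ∈ Finset.HasAntidiagonal.antidiagonal N, ∑ q ∈ Finset.HasAntidiagonal.antidiagonal p.2,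
    ((-1 : ℂ) ^ q.1 * (Nat.multichoose p.1 q.1 : ℂ)) •
      (x p.1 * (derivative ℂ)^[q.1] (y q.2))⟩

theorem coeff_one (n : ℕ) : (1 : Ahat).coeff n = if n = 0 then 1 else 0 := rfl

theorem coeff_mul (x y : Ahat) (N : ℕ) : (x * y).coeff N =
    ∑ p ∈ Finset.HasAntidiagonal.antidiagonal N, ∑ q ∈ Finset.HasAntidiagonal.antidiagonal p.2,
      ((-1 : ℂ) ^ q.1 * (Nat.multichoose p.1 q.1 : ℂ)) •
        (x.coeff p.1 * (derivative ℂ)^[q.1] (y.coeff q.2)) := rfl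

end Ahat

theorem Ahat.box_sum {M : Type*} [AddCommMonoid M] (K : ℕ) (f : ℕ → ℕ → M)
    (hf : ∀ i j, K ≤ i + j → f i j = 0) :
    ∑ N ∈ Finset.range K, ∑ p ∈ Finset.HasAntidiagonal.antidiagonal N, f p.1 p.2 =
      ∑ i ∈ Finset.range K, ∑ j ∈ Finset.range K, f i j := by
  rw [← Finset.sum_product', Finset.sum_sigma']
  refine Finset.sum_bij_ne_zero (fun s _ _ => s.2) ?_ ?_ ?_ ?_
  · rintro ⟨N, p⟩ h _
    simp only [Finset.mem_sigma, Finset.mem_range, Finset.HasAntidiagonal.mem_antidiagonal] at h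
    simp only [Finset.mem_product, Finset.mem_range]
    omega
  · rintro ⟨N, p⟩ h _ ⟨N', p'⟩ h' _ e
    simp only [Finset.mem_sigma, Finset.mem_range, Finset.HasAntidiagonal.mem_antidiagonal] at h h'
    simp only at e
    subst e
    have : N = N' := by omega
    subst this
    rfl
  · rintro ⟨i, j⟩ h hne
    have : i + j < K := by
      by_contra hc
      exact hne (hf i j (by omega))
    exact ⟨⟨i + j, (i, j)⟩, by simp [this], hne, rfl⟩
  · rintro ⟨N, p⟩ h _
    rfl

namespace AbRep

/-- All components of `v` are divisible by `X^t`. -/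
def Ord {ι : Type} (t : ℕ) (v : ι → PowerSeries ℂ) : Prop :=
  ∀ j s, s < t → PowerSeries.coeff s (v j) = 0

theorem Ord.sum {ι : Type} {t : ℕ} {κ : Type*} (s : Finset κ) (f : κ → ι → PowerSeries ℂ)
    (h : ∀ i ∈ s, Ord t (f i)) : Ord t (∑ i ∈ s, f i) := by
  intro j r hr
  simp only [Finset.sum_apply, map_sum]
  exact Finset.sum_eq_zero fun i hi => h i hi j r hr

end AbRep

/-- Auxiliary data from which an action of `Â` is built on `ι → ℂ[[X]]`: an action `G` of `ℂ[[a]]`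
and an operator `B` raising the order, such that `B T(a) = T(a) B - B T'(a) B`. -/
structure AbRep (ι : Type) where
  G : PowerSeries ℂ →ₐ[ℂ] Module.End ℂ (ι → PowerSeries ℂ)
  B : Module.End ℂ (ι → PowerSeries ℂ)
  hG : ∀ g t v, AbRep.Ord t v → AbRep.Ord t (G g v)
  hB : ∀ t v, AbRep.Ord t v → AbRep.Ord (t + 1) (B v)
  comm : ∀ g v, B (G g v) = G g (B v) - B (G (derivative ℂ g) (B v))

namespace AbRep

variable {ι : Type} (R : AbRep ι)

theorem hB_pow (n : ℕ) (t : ℕ) (v : ι → PowerSeries ℂ) (hv : Ord t v) :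
    Ord (t + n) ((R.B ^ n) v) := by
  induction n with
  | zero => simpa using hv
  | succ n ih =>
    rw [pow_succ', Module.End.mul_apply]
    exact R.hB _ _ ih

theorem ord_zero (v : ι → PowerSeries ℂ) : Ord 0 v := fun _ _ h => absurd h (by omega)

/-- The action of `∑ P_ν(a) b^ν`. -/
def act (x : Ahat) : Module.End ℂ (ι → PowerSeries ℂ) where
  toFun v := fun j => PowerSeries.mk fun t =>
    ∑ n ∈ Finset.range (t + 1), PowerSeries.coeff t (R.G (x.coeff n) ((R.B ^ n) v) j)
  map_add' v w := by
    funext j; ext t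
    simp [Finset.sum_add_distrib]
  map_smul' c v := by
    funext j; ext t
    simp [Finset.mul_sum]

theorem coeff_act (x : Ahat) (v : ι → PowerSeries ℂ) (j : ι) {t K : ℕ} (h : t < K) :
    PowerSeries.coeff t (R.act x v j) =
      ∑ n ∈ Finset.range K, PowerSeries.coeff t (R.G (x.coeff n) ((R.B ^ n) v) j) := by
  have h0 : R.act x v j = PowerSeries.mk fun t => ∑ n ∈ Finset.range (t + 1),
      PowerSeries.coeff t (R.G (x.coeff n) ((R.B ^ n) v) j) := rfl
  rw [h0, PowerSeries.coeff_mk]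
  refine Finset.sum_subset (by intro i; simp; omega) fun n _ hn => ?_
  have := R.hG (x.coeff n) _ _ (R.hB_pow n 0 v (ord_zero v))
  exact this j t (by simp at hn; omega)

/-- `act` agrees with a partial sum up to high order. -/
theorem act_sub_ord (x : Ahat) (v : ι → PowerSeries ℂ) (K : ℕ) :
    Ord K (R.act x v - ∑ n ∈ Finset.range K, R.G (x.coeff n) ((R.B ^ n) v)) := by
  intro j s hs
  simp only [Pi.sub_apply, map_sub, Finset.sum_apply, map_sum]
  rw [R.coeff_act x v j hs, sub_self]

theorem comm_one (K : ℕ) (g : PowerSeries ℂ) (v : ι → PowerSeries ℂ) :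
    R.B (R.G g v) = ∑ k ∈ Finset.range K, (-1 : ℂ) ^ k •
        R.G ((derivative ℂ)^[k] g) ((R.B ^ (k + 1)) v)
      + (-1 : ℂ) ^ K • R.B (R.G ((derivative ℂ)^[K] g) ((R.B ^ K) v)) := by
  induction K with
  | zero => simp
  | succ K ih =>
    rw [ih, Finset.sum_range_succ, add_assoc, R.comm ((derivative ℂ)^[K] g)]
    congr 1
    rw [Function.iterate_succ_apply', pow_succ' R.B K, Module.End.mul_apply, smul_sub, pow_succ,
      sub_eq_add_neg]
    congr 1
    simp

theorem multichoose_sum (n N : ℕ) :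
    ∑ k ∈ Finset.range (N + 1), Nat.multichoose n k = Nat.multichoose (n + 1) N := by
  induction N with
  | zero => simp
  | succ N ih => rw [Finset.sum_range_succ, ih, Nat.multichoose_succ_succ, add_comm]

theorem comm_pow (n K : ℕ) (g : PowerSeries ℂ) (v : ι → PowerSeries ℂ) :
    Ord K ((R.B ^ n) (R.G g v) - ∑ k ∈ Finset.range K,
      ((-1 : ℂ) ^ k * (Nat.multichoose n k : ℂ)) •
        R.G ((derivative ℂ)^[k] g) ((R.B ^ (n + k)) v)) := by
  induction n generalizing K with
  | zero =>
    rcases K with _ | K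
    · exact ord_zero _
    · rw [Finset.sum_eq_single 0]
      · intro j s hs; simp
      · intro k _ hk
        obtain ⟨k, rfl⟩ := Nat.exists_eq_succ_of_ne_zero hk
        simp
      · simp
  | succ n ih =>
    -- the general term of the double sum
    let F : ℕ → ℕ → (ι → PowerSeries ℂ) := fun k l =>
      ((-1 : ℂ) ^ (k + l) * (Nat.multichoose n k : ℂ)) •
        R.G ((derivative ℂ)^[k + l] g) ((R.B ^ (n + 1 + (k + l))) v)
    have hF : ∀ k l, Ord (k + l) (F k l) := by
      intro k l j s hs
      have h1 := R.hB_pow (n + 1 + (k + l)) 0 v (ord_zero v)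
      have h2 := R.hG ((derivative ℂ)^[k + l] g) _ _ h1 j s (by omega)
      simp only [F, Pi.smul_apply]
      rw [LinearMap.map_smul, h2, smul_zero]
    intro j s hs
    have e1 : PowerSeries.coeff s ((R.B ^ (n + 1)) (R.G g v) j) =
        ∑ k ∈ Finset.range K, ∑ l ∈ Finset.range K, PowerSeries.coeff s (F k l j) := by
      have h1 := R.hB _ _ (ih K) j s (by omega)
      rw [map_sub, Pi.sub_apply, map_sub, sub_eq_zero, ← Module.End.mul_apply, ← pow_succ'] at h1
      rw [h1, map_sum, Finset.sum_apply, map_sum]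
      refine Finset.sum_congr rfl fun k _ => ?_
      rw [LinearMap.map_smul, R.comm_one K, smul_add, Pi.add_apply, map_add, Finset.smul_sum,
        Finset.sum_apply, map_sum]
      have h2 : Ord K (R.B (R.G ((derivative ℂ)^[K] ((derivative ℂ)^[k] g))
          ((R.B ^ K) ((R.B ^ (n + k)) v)))) := by
        have := R.hB _ _ (R.hG ((derivative ℂ)^[K] ((derivative ℂ)^[k] g)) _ _
          (R.hB_pow K 0 ((R.B ^ (n + k)) v) (ord_zero _)))
        intro j s hs
        exact this j s (by omega)
      rw [Pi.smul_apply, Pi.smul_apply, LinearMap.map_smul, LinearMap.map_smul, h2 j s hs,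
        smul_zero, smul_zero, add_zero]
      refine Finset.sum_congr rfl fun l _ => ?_
      simp only [F]
      rw [smul_smul, ← Function.iterate_add_apply,
        ← Module.End.mul_apply (R.B ^ (l + 1)), ← pow_add R.B]
      rw [show l + k = k + l by ring, show l + 1 + (n + k) = n + 1 + (k + l) by ring]
      rw [show (-1 : ℂ) ^ k * (Nat.multichoose n k : ℂ) * (-1) ^ l =
        (-1) ^ (k + l) * (Nat.multichoose n k : ℂ) by ring]
    rw [Pi.sub_apply, map_sub, e1, sub_eq_zero, ← Ahat.box_sum K (fun k l =>
      PowerSeries.coeff s (F k l j)) (fun k l h => hF k l j s (by omega)), Finset.sum_apply,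
      map_sum]
    refine Finset.sum_congr rfl fun N _ => ?_
    rw [← multichoose_sum, Nat.cast_sum, Finset.mul_sum, Finset.sum_smul, Finset.sum_apply,
      map_sum, Finset.Nat.sum_antidiagonal_eq_sum_range_succ
        (fun k l => PowerSeries.coeff s (F k l j))]
    refine Finset.sum_congr rfl fun k hk => ?_
    have : k + (N - k) = N := by simp at hk; omega
    simp only [F, this]

theorem act_mul (x y : Ahat) : R.act (x * y) = R.act x * R.act y := by
  ext v j t
  rw [Module.End.mul_apply]
  set K := t + 1 with hK
  have ht : t < K := by omega
  let F : ℕ → ℕ → ℕ → (ι → PowerSeries ℂ) := fun n k m =>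
    ((-1 : ℂ) ^ k * (Nat.multichoose n k : ℂ)) •
      R.G (x.coeff n * (derivative ℂ)^[k] (y.coeff m)) ((R.B ^ (n + k + m)) v)
  have hF : ∀ n k m, Ord (n + k + m) (F n k m) := by
    intro n k m j s hs
    have h1 := R.hB_pow (n + k + m) 0 v (ord_zero v)
    have h2 := R.hG (x.coeff n * (derivative ℂ)^[k] (y.coeff m)) _ _ h1 j s (by omega)
    simp only [F, Pi.smul_apply]
    rw [LinearMap.map_smul, h2, smul_zero]
  have hR : PowerSeries.coeff t (R.act x (R.act y v) j) =
      ∑ n ∈ Finset.range K, ∑ k ∈ Finset.range K, ∑ m ∈ Finset.range K,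
        PowerSeries.coeff t (F n k m j) := by
    rw [R.coeff_act x _ j ht]
    refine Finset.sum_congr rfl fun n _ => ?_
    have h1 : Ord K ((R.B ^ n) (R.act y v) -
        (R.B ^ n) (∑ m ∈ Finset.range K, R.G (y.coeff m) ((R.B ^ m) v))) := by
      rw [← map_sub]
      intro j s hs
      exact R.hB_pow n K _ (R.act_sub_ord y v K) j s (by omega)
    have h2 := R.hG (x.coeff n) _ _ h1 j t ht
    rw [map_sub, Pi.sub_apply, map_sub, sub_eq_zero] at h2
    rw [h2, map_sum, map_sum, Finset.sum_apply, map_sum, Finset.sum_comm]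
    refine Finset.sum_congr rfl fun m _ => ?_
    have h3 := R.hG (x.coeff n) _ _ (R.comm_pow n K (y.coeff m) ((R.B ^ m) v)) j t ht
    rw [map_sub, Pi.sub_apply, map_sub, sub_eq_zero] at h3
    rw [h3, map_sum, Finset.sum_apply, map_sum]
    refine Finset.sum_congr rfl fun k _ => ?_
    simp only [F]
    rw [LinearMap.map_smul, map_mul, Module.End.mul_apply, pow_add _ (n + k) m,
      Module.End.mul_apply]
  rw [hR, R.coeff_act _ v j ht]
  have hL : ∀ N, PowerSeries.coeff t (R.G ((x * y).coeff N) ((R.B ^ N) v) j) =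
      ∑ p ∈ Finset.HasAntidiagonal.antidiagonal N, ∑ q ∈ Finset.HasAntidiagonal.antidiagonal p.2,
        PowerSeries.coeff t (F p.1 q.1 q.2 j) := by
    intro N
    rw [Ahat.coeff_mul, map_sum, LinearMap.sum_apply, Finset.sum_apply, map_sum]
    refine Finset.sum_congr rfl fun p hp => ?_
    rw [map_sum, LinearMap.sum_apply, Finset.sum_apply, map_sum]
    refine Finset.sum_congr rfl fun q hq => ?_
    rw [Finset.HasAntidiagonal.mem_antidiagonal] at hp hq
    simp only [F]
    rw [map_smul, LinearMap.smul_apply, show p.1 + q.1 + q.2 = N by omega]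
  simp only [hL]
  rw [Ahat.box_sum K (fun n r => ∑ q ∈ Finset.HasAntidiagonal.antidiagonal r, PowerSeries.coeff t (F n q.1 q.2 j))]
  · refine Finset.sum_congr rfl fun n _ => ?_
    exact Ahat.box_sum K (fun k m => PowerSeries.coeff t (F n k m j))
      (fun k m h => hF n k m j t (by omega))
  · intro n r h
    refine Finset.sum_eq_zero fun q hq => hF n q.1 q.2 j t ?_
    rw [Finset.HasAntidiagonal.mem_antidiagonal] at hq
    omega

end AbRep

namespace Ahat

/-- The primitive vanishing at `0`. -/
def prim : PowerSeries ℂ →ₗ[ℂ] PowerSeries ℂ where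
  toFun f := PowerSeries.mk fun n => PowerSeries.coeff (n - 1) f / (n : ℂ)
  map_add' f g := by ext n; simp [add_div]
  map_smul' c f := by ext n; simp [mul_div_assoc]

theorem coeff_prim (f : PowerSeries ℂ) (n : ℕ) :
    PowerSeries.coeff n (prim f) = PowerSeries.coeff (n - 1) f / (n : ℂ) := by
  have h0 : prim f = PowerSeries.mk fun n => PowerSeries.coeff (n - 1) f / (n : ℂ) := rfl
  rw [h0, PowerSeries.coeff_mk]

theorem derivative_prim (f : PowerSeries ℂ) : derivative ℂ (prim f) = f := by
  ext n
  rw [coeff_derivative, coeff_prim]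
  have : ((n : ℂ) + 1) ≠ 0 := by exact_mod_cast n.succ_ne_zero
  push_cast
  rw [div_mul_cancel₀ _ this]

theorem constantCoeff_prim (f : PowerSeries ℂ) : constantCoeff (prim f) = 0 := by
  rw [← coeff_zero_eq_constantCoeff_apply, coeff_prim]; simp

theorem prim_parts (g f : PowerSeries ℂ) :
    prim (g * f) = g * prim f - prim (derivative ℂ g * prim f) := by
  apply derivative.ext
  · simp only [map_sub, derivative_prim, Derivation.leibniz, smul_eq_mul]
    ring
  · simp [constantCoeff_prim]

theorem ord_mul {ι : Type} (g : PowerSeries ℂ) (t : ℕ) (v : ι → PowerSeries ℂ)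
    (hv : AbRep.Ord t v) : AbRep.Ord t (Algebra.lsmul ℂ ℂ (ι → PowerSeries ℂ) g v) := by
  intro j s hs
  simp only [Algebra.lsmul_coe, Pi.smul_apply, smul_eq_mul, PowerSeries.coeff_mul]
  refine Finset.sum_eq_zero fun p hp => ?_
  rw [Finset.HasAntidiagonal.mem_antidiagonal] at hp
  rw [hv j p.2 (by omega), mul_zero]

theorem ord_prim (t : ℕ) (v : Unit → PowerSeries ℂ) (hv : AbRep.Ord t v) :
    AbRep.Ord (t + 1) (prim.compLeft Unit v) := by
  intro j s hs
  simp only [LinearMap.compLeft_apply, Function.comp_apply, coeff_prim]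
  rcases s with _ | s
  · simp
  · rw [hv j _ (by simpa using hs), zero_div]

/-- `Â` acting on `ℂ[[s]]`: `a` is multiplication by `s`, `b` is the primitive vanishing at `0`. -/
def primRep : AbRep Unit where
  G := Algebra.lsmul ℂ ℂ (Unit → PowerSeries ℂ)
  B := prim.compLeft Unit
  hG := ord_mul
  hB := ord_prim
  comm g v := by
    funext j
    simp [prim_parts g (v j)]

theorem primRep_pow_X (n m : ℕ) (j : Unit) :
    (primRep.B ^ n) (fun _ => (X : PowerSeries ℂ) ^ m) j =
      C (∏ i ∈ Finset.range n, ((m : ℂ) + i + 1))⁻¹ * X ^ (m + n) := by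
  induction n with
  | zero => simp
  | succ n ih =>
    rw [pow_succ', Module.End.mul_apply]
    change prim ((primRep.B ^ n) (fun _ => (X : PowerSeries ℂ) ^ m) j) = _
    rw [ih]
    ext t
    rw [coeff_prim, PowerSeries.coeff_C_mul, PowerSeries.coeff_C_mul, coeff_X_pow, coeff_X_pow,
      Finset.prod_range_succ]
    rcases t with _ | t
    · simp
    · by_cases h : t = m + n
      · subst h
        simp [← add_assoc]
        ring
      · have h' : ¬ (t + 1 = m + (n + 1)) := by omega
        simp [h, h']

theorem rational_independent (n : ℕ) (c : ℕ → ℂ)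
    (h : ∀ m : ℕ, ∑ k ∈ Finset.range (n + 1),
      c k * ∏ i ∈ Finset.Ico k n, ((m : ℂ) + i + 1) = 0) : ∀ k ≤ n, c k = 0 := by
  induction n with
  | zero =>
    intro k hk
    obtain rfl : k = 0 := by omega
    simpa using h 0
  | succ n ih =>
    let p : Polynomial ℂ := ∑ k ∈ Finset.range (n + 2),
      Polynomial.C (c k) * ∏ i ∈ Finset.Ico k (n + 1),
        (Polynomial.X + Polynomial.C (i : ℂ) + 1)
    have hp : p = 0 := by
      refine Polynomial.eq_zero_of_infinite_isRoot p
        (Set.infinite_of_injective_forall_mem (f := fun m : ℕ => (m : ℂ)) Nat.cast_injective ?_)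
      intro m
      simpa [p, Polynomial.IsRoot, Polynomial.eval_finsetSum, Polynomial.eval_prod] using h m
    have hlast : c (n + 1) = 0 := by
      have h1 : p.eval (-(n : ℂ) - 1) = 0 := by rw [hp]; simp
      simp only [p, Polynomial.eval_finsetSum, Polynomial.eval_mul, Polynomial.eval_C,
        Polynomial.eval_prod, Polynomial.eval_add, Polynomial.eval_X, Polynomial.eval_one] at h1
      rw [Finset.sum_range_succ, Finset.sum_eq_zero] at h1
      · simpa using h1
      · intro k hk
        rw [Finset.prod_eq_zero (i := n)]
        · simp
        · simp at hk ⊢; omega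
        · ring
    intro k hk
    rcases Nat.lt_or_ge n k with h2 | h2
    · obtain rfl : k = n + 1 := by omega
      exact hlast
    · refine ih (fun m => ?_) k h2
      have h3 := h m
      rw [Finset.sum_range_succ, hlast, zero_mul, add_zero] at h3
      have h4 : ((m : ℂ) + n + 1) ≠ 0 := by exact_mod_cast (m + n).succ_ne_zero
      refine (mul_eq_zero.1 ?_).resolve_right h4
      rw [Finset.sum_mul, ← h3]
      refine Finset.sum_congr rfl fun k hk => ?_
      rw [Finset.prod_Ico_succ_top (by simp at hk; omega)]
      ring

theorem primRep_injective (x : Ahat) (hx : primRep.act x = 0) : x = 0 := by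
  ext ν d
  simp only [coeff_zero, map_zero]
  let n := ν + d
  have key := rational_independent n (fun k => PowerSeries.coeff (n - k) (x.coeff k)) ?_ ν
    (by omega)
  · simpa [n] using key
  intro m
  have h1 : PowerSeries.coeff (m + n) (primRep.act x (fun _ => X ^ m) ()) = 0 := by
    rw [hx]; simp
  rw [primRep.coeff_act x _ () (Nat.lt_succ_self (m + n))] at h1
  have hne : ∏ i ∈ Finset.range n, ((m : ℂ) + i + 1) ≠ 0 :=
    Finset.prod_ne_zero_iff.2 fun i _ => by exact_mod_cast (m + i).succ_ne_zero
  have h2 : ∑ k ∈ Finset.range (n + 1), PowerSeries.coeff (m + n)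
      (primRep.G (x.coeff k) ((primRep.B ^ k) fun _ => X ^ m) ()) = 0 := by
    rw [← h1]
    refine Finset.sum_subset (by intro i; simp; omega) fun k _ hk => ?_
    simp only [primRep, Algebra.lsmul_coe, Pi.smul_apply, smul_eq_mul]
    have := primRep_pow_X k m ()
    simp only [primRep] at this
    rw [this, mul_left_comm, PowerSeries.coeff_C_mul, PowerSeries.coeff_mul_X_pow', if_neg]
    · simp
    · simp at hk; omega
  have h3 := congrArg (fun z => z * ∏ i ∈ Finset.range n, ((m : ℂ) + i + 1)) h2
  simp only [zero_mul, Finset.sum_mul] at h3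
  rw [← h3]
  refine Finset.sum_congr rfl fun k hk => ?_
  have hk' : k ≤ n := by simp at hk; omega
  change _ = PowerSeries.coeff (m + n)
      (x.coeff k * ((primRep.B ^ k) (fun _ => (X : PowerSeries ℂ) ^ m) ())) * _
  rw [primRep_pow_X, mul_left_comm, PowerSeries.coeff_C_mul, PowerSeries.coeff_mul_X_pow',
    if_pos (by omega), show m + n - (m + k) = n - k by omega,
    ← Finset.prod_range_mul_prod_Ico _ hk']
  have hne' : ∏ i ∈ Finset.range k, ((m : ℂ) + i + 1) ≠ 0 :=
    Finset.prod_ne_zero_iff.2 fun i _ => by exact_mod_cast (m + i).succ_ne_zero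
  field_simp

end Ahat

namespace AbRep

variable {ι : Type} (R : AbRep ι)

theorem act_add (x y : Ahat) : R.act (x + y) = R.act x + R.act y := by
  ext v j t
  rw [LinearMap.add_apply, Pi.add_apply, map_add, R.coeff_act _ v j (Nat.lt_succ_self t),
    R.coeff_act _ v j (Nat.lt_succ_self t), R.coeff_act _ v j (Nat.lt_succ_self t),
    ← Finset.sum_add_distrib]
  simp

theorem act_zero : R.act 0 = 0 := by
  have := R.act_add 0 0
  simpa using this

theorem act_one : R.act 1 = 1 := by
  ext v j t
  rw [R.coeff_act _ v j (Nat.lt_succ_self t), Finset.sum_eq_single 0]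
  · simp [Ahat.coeff_one]
  · intro n _ hn
    simp [Ahat.coeff_one, hn]
  · simp

end AbRep

namespace Ahat

theorem act_inj {x y : Ahat} (h : primRep.act x = primRep.act y) : x = y := by
  rw [← sub_eq_zero]
  apply primRep_injective
  have := primRep.act_add (x - y) y
  rw [sub_add_cancel, h] at this
  simpa using this

instance : Ring Ahat :=
  { (inferInstance : AddCommGroup Ahat) with
    mul := (· * ·)
    one := 1
    mul_assoc := fun x y z => act_inj (by simp only [AbRep.act_mul, mul_assoc])
    one_mul := fun x => act_inj (by simp only [AbRep.act_mul, AbRep.act_one, one_mul])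
    mul_one := fun x => act_inj (by simp only [AbRep.act_mul, AbRep.act_one, mul_one])
    left_distrib := fun x y z => act_inj (by simp only [AbRep.act_mul, AbRep.act_add, mul_add])
    right_distrib := fun x y z => act_inj (by simp only [AbRep.act_mul, AbRep.act_add, add_mul])
    zero_mul := fun x => act_inj (by simp only [AbRep.act_mul, AbRep.act_zero, zero_mul])
    mul_zero := fun x => act_inj (by simp only [AbRep.act_mul, AbRep.act_zero, mul_zero]) }

end Ahat

/-- The action of `Â` as a ring homomorphism. -/
def AbRep.hom {ι : Type} (R : AbRep ι) : Ahat →+* Module.End ℂ (ι → PowerSeries ℂ) where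
  toFun := R.act
  map_one' := R.act_one
  map_mul' := R.act_mul
  map_zero' := R.act_zero
  map_add' := R.act_add

namespace Ahat

/-- The element `a`. -/
def a : Ahat := ofAFun X

/-- The element `b`. -/
def b : Ahat := ofBFun X

theorem coeff_ofAFun (S : PowerSeries ℂ) (n : ℕ) :
    (ofAFun S).coeff n = if n = 0 then S else 0 := rfl

theorem coeff_ofBFun (S : PowerSeries ℂ) (n : ℕ) :
    (ofBFun S).coeff n = C (PowerSeries.coeff n S) := rfl

theorem coeff_ofAFun_mul (S : PowerSeries ℂ) (x : Ahat) (N : ℕ) :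
    (ofAFun S * x).coeff N = S * x.coeff N := by
  rw [coeff_mul, Finset.sum_eq_single (0, N), Finset.sum_eq_single (0, N)]
  · simp [coeff_ofAFun]
  · rintro ⟨k, m⟩ h hne
    rcases k with _ | k
    · simp at h hne; omega
    · simp
  · simp
  · rintro ⟨n, m⟩ h hne
    have : n ≠ 0 := by rintro rfl; simp at h hne; omega
    simp [coeff_ofAFun, this]
  · simp

theorem iterate_derivative_C (k : ℕ) (c : ℂ) :
    (derivative ℂ)^[k + 1] (C c) = 0 := by
  rw [Function.iterate_succ_apply, derivative_C]
  exact iterate_map_zero (derivative ℂ) k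

theorem coeff_mul_ofBFun (x : Ahat) (S : PowerSeries ℂ) (N : ℕ) :
    (x * ofBFun S).coeff N =
      ∑ p ∈ Finset.HasAntidiagonal.antidiagonal N,
        x.coeff p.1 * C (PowerSeries.coeff p.2 S) := by
  rw [coeff_mul]
  refine Finset.sum_congr rfl fun p _ => ?_
  rw [Finset.sum_eq_single (0, p.2)]
  · simp [coeff_ofBFun]
  · rintro ⟨k, m⟩ h hne
    rcases k with _ | k
    · simp at h hne; omega
    · rw [coeff_ofBFun, iterate_derivative_C]; simp
  · simp

/-- The embedding `ℂ[[a]] → Â`. -/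
def ofA : PowerSeries ℂ →+* Ahat where
  toFun := ofAFun
  map_one' := rfl
  map_zero' := by ext n; simp [coeff_ofAFun]
  map_add' S T := by ext1 n; by_cases h : n = 0 <;> simp [coeff_ofAFun, h]
  map_mul' S T := by ext1 n; by_cases h : n = 0 <;> simp [coeff_ofAFun_mul, coeff_ofAFun, h]

/-- The embedding `ℂ[[b]] → Â`. -/
def ofB : PowerSeries ℂ →+* Ahat where
  toFun := ofBFun
  map_one' := by
    ext1 n
    by_cases h : n = 0 <;> simp [coeff_ofBFun, coeff_one, PowerSeries.coeff_one, h]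
  map_zero' := by ext1 n; simp [coeff_ofBFun]
  map_add' S T := by ext1 n; simp [coeff_ofBFun]
  map_mul' S T := by
    ext1 n
    rw [coeff_mul_ofBFun]
    simp only [coeff_ofBFun, PowerSeries.coeff_mul, map_sum, map_mul]

/-- The embedding of the scalars `ℂ → Â`. -/
def scalar : ℂ →+* Ahat := ofB.comp C

theorem scalar_eq (c : ℂ) : scalar c = ofA (C c) := by
  ext1 n
  change (ofBFun (C c)).coeff n = (ofAFun (C c)).coeff n
  by_cases h : n = 0 <;> simp [coeff_ofBFun, coeff_ofAFun, PowerSeries.coeff_C, h]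

theorem scalar_comm (c : ℂ) (x : Ahat) : scalar c * x = x * scalar c := by
  ext1 N
  rw [show x * scalar c = x * ofBFun (C c) from rfl, coeff_mul_ofBFun, scalar_eq,
    show ofA (C c) * x = ofAFun (C c) * x from rfl, coeff_ofAFun_mul,
    Finset.sum_eq_single (N, 0)]
  · simp [mul_comm]
  · rintro ⟨i, j⟩ h hne
    have : j ≠ 0 := by rintro rfl; simp at h hne; omega
    simp [PowerSeries.coeff_C, this]
  · simp

theorem coeff_mul_b (x : Ahat) (N : ℕ) :
    (x * b).coeff N = if N = 0 then 0 else x.coeff (N - 1) := by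
  rw [show x * b = x * ofBFun X from rfl, coeff_mul_ofBFun]
  rcases N with _ | N
  · simp
  · rw [Finset.sum_eq_single (N, 1)]
    · simp
    · rintro ⟨i, j⟩ h hne
      have : j ≠ 1 := by rintro rfl; simp at h hne; omega
      simp [PowerSeries.coeff_X, this]
    · simp

end Ahat

namespace AbRep

variable {ι : Type} (R : AbRep ι)

theorem act_ofA (S : PowerSeries ℂ) : R.act (Ahat.ofA S) = R.G S := by
  ext v j t
  rw [R.coeff_act _ v j (Nat.lt_succ_self t), Finset.sum_eq_single 0]
  · simp [Ahat.ofA, Ahat.coeff_ofAFun]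
  · intro n _ hn
    simp [Ahat.ofA, Ahat.coeff_ofAFun, hn]
  · simp

theorem act_b : R.act Ahat.b = R.B := by
  ext v j t
  rw [R.coeff_act _ v j (show t < t + 2 by omega), Finset.sum_eq_single 1]
  · simp [Ahat.b, Ahat.coeff_ofBFun]
  · intro n _ hn
    simp [Ahat.b, Ahat.coeff_ofBFun, PowerSeries.coeff_X, hn]
  · simp

theorem act_pow (x : Ahat) (n : ℕ) : R.act (x ^ n) = R.act x ^ n := map_pow R.hom x n

end AbRep

namespace Ahat

/-- The defining commutation relation. -/
theorem a_mul_b_sub : a * b - b * a = b ^ 2 := by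
  apply act_inj
  change primRep.hom _ = primRep.hom _
  rw [map_sub, map_mul, map_mul, map_pow]
  change primRep.act (ofA X) * primRep.act b - primRep.act b * primRep.act (ofA X) =
    primRep.act b ^ 2
  rw [AbRep.act_ofA, AbRep.act_b]
  refine LinearMap.ext fun v => ?_
  have := primRep.comm X v
  simp only [derivative_X, map_one, Module.End.one_apply] at this
  rw [LinearMap.sub_apply, Module.End.mul_apply, Module.End.mul_apply, this, pow_two,
    Module.End.mul_apply]
  abel

end Ahat

/-- A change of variable: `θ ∈ ℂ[[a]]` with `θ(0) = 0` and `θ'(0) ≠ 0`. -/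
structure ChangeOfVariable where
  series : PowerSeries ℂ
  zero : constantCoeff series = 0
  deriv_ne_zero : PowerSeries.coeff 1 series ≠ 0

namespace ChangeOfVariable

variable (θ : ChangeOfVariable)

theorem hasSubst : HasSubst θ.series := HasSubst.of_constantCoeff_zero' θ.zero

/-- `α = θ(a)`. -/
def alpha : Ahat := Ahat.ofA θ.series

/-- `β = b θ'(a)`. -/
def beta : Ahat := Ahat.b * Ahat.ofA (derivative ℂ θ.series)

/-- `Θ(∑ P_ν(a) b^ν) = ∑ P_ν(α) β^ν`; the sum is finite in each `b`-degree since
`β^ν ∈ Â b^ν`. -/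
def ThetaFun (x : Ahat) : Ahat := fun n =>
  ∑ k ∈ Finset.range (n + 1), (Ahat.ofA ((x.coeff k).subst θ.series) * θ.beta ^ k).coeff n

/-- The operators `α` and `β` on `ℂ[[s]]`. -/
def rep : AbRep Unit where
  G := (Algebra.lsmul ℂ ℂ (Unit → PowerSeries ℂ)).comp (substAlgHom θ.hasSubst)
  B := Ahat.primRep.B * Algebra.lsmul ℂ ℂ (Unit → PowerSeries ℂ) (derivative ℂ θ.series)
  hG g := Ahat.ord_mul _
  hB t v hv := Ahat.ord_prim _ _ (Ahat.ord_mul _ _ _ hv)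
  comm g v := by
    funext j
    simp only [Module.End.mul_apply, AlgHom.comp_apply, coe_substAlgHom]
    simp only [Ahat.primRep, Algebra.lsmul_coe, LinearMap.compLeft_apply, Function.comp_apply,
      Pi.smul_apply, Pi.sub_apply, smul_eq_mul]
    rw [mul_left_comm, Ahat.prim_parts, derivative_subst θ.hasSubst]
    congr 2
    ring

theorem coeff_mul_of_lt (x y : Ahat) {k n : ℕ} (hx : ∀ i < k, x.coeff i = 0) (hn : n < k) :
    (x * y).coeff n = 0 := by
  rw [Ahat.coeff_mul]
  refine Finset.sum_eq_zero fun p hp => Finset.sum_eq_zero fun q _ => ?_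
  rw [Finset.HasAntidiagonal.mem_antidiagonal] at hp
  rw [hx p.1 (by omega), zero_mul, smul_zero]

theorem coeff_beta_mul (x : Ahat) {k : ℕ} (hx : ∀ i < k, x.coeff i = 0) :
    ∀ i < k + 1, (x * θ.beta).coeff i = 0 := by
  intro i hi
  rw [beta, ← mul_assoc]
  refine coeff_mul_of_lt _ _ (fun j hj => ?_) hi
  rw [Ahat.coeff_mul_b]
  split_ifs with h
  · rfl
  · exact hx _ (by omega)

theorem coeff_beta_pow (k : ℕ) : ∀ i < k, (θ.beta ^ k).coeff i = 0 := by
  induction k with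
  | zero => intro i hi; omega
  | succ k ih => rw [pow_succ]; exact θ.coeff_beta_mul _ ih

theorem act_beta : Ahat.primRep.act θ.beta = θ.rep.B := by
  rw [beta, AbRep.act_mul, AbRep.act_b, AbRep.act_ofA]
  rfl

theorem act_ThetaFun (x : Ahat) : Ahat.primRep.act (θ.ThetaFun x) = θ.rep.act x := by
  refine LinearMap.ext fun v => funext fun j => PowerSeries.ext fun t => ?_
  have ht : t < t + 1 := Nat.lt_succ_self t
  rw [θ.rep.coeff_act x v j ht, Ahat.primRep.coeff_act _ v j ht]
  have h1 : ∀ n ∈ Finset.range (t + 1), (θ.ThetaFun x).coeff n =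
      ∑ k ∈ Finset.range (t + 1), (x.coeff k).subst θ.series * (θ.beta ^ k).coeff n := by
    intro n hn
    have : (θ.ThetaFun x).coeff n = ∑ k ∈ Finset.range (n + 1),
        (x.coeff k).subst θ.series * (θ.beta ^ k).coeff n := by
      have h0 : (θ.ThetaFun x).coeff n = ∑ k ∈ Finset.range (n + 1),
        (Ahat.ofA ((x.coeff k).subst θ.series) * θ.beta ^ k).coeff n := rfl
      rw [h0]
      exact Finset.sum_congr rfl fun k _ => Ahat.coeff_ofAFun_mul _ _ _
    rw [this]
    refine Finset.sum_subset (by intro i; simp at hn ⊢; omega) fun k _ hk => ?_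
    rw [θ.coeff_beta_pow k n (by simp at hk; omega), mul_zero]
  rw [Finset.sum_congr rfl fun n hn => by
    rw [h1 n hn, map_sum, LinearMap.sum_apply, Finset.sum_apply, map_sum], Finset.sum_comm]
  refine Finset.sum_congr rfl fun k _ => ?_
  have h2 := Ahat.primRep.act_sub_ord (θ.beta ^ k) v (t + 1)
  have h3 := Ahat.primRep.hG ((x.coeff k).subst θ.series) _ _ h2 j t ht
  rw [map_sub, Pi.sub_apply, map_sub, sub_eq_zero, AbRep.act_pow, act_beta, map_sum,
    Finset.sum_apply, map_sum] at h3
  rw [show θ.rep.G (x.coeff k) = Ahat.primRep.G ((x.coeff k).subst θ.series) by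
    rw [← coe_substAlgHom θ.hasSubst]; rfl, h3]
  refine Finset.sum_congr rfl fun n _ => ?_
  rw [map_mul, Module.End.mul_apply]

/-- The endomorphism `Θ` of `Â` with `Θ(a) = α` and `Θ(b) = β`. -/
def Theta : Ahat →+* Ahat where
  toFun := θ.ThetaFun
  map_one' := Ahat.act_inj (by rw [act_ThetaFun, AbRep.act_one, AbRep.act_one])
  map_mul' x y := Ahat.act_inj (by simp only [act_ThetaFun, AbRep.act_mul])
  map_zero' := Ahat.act_inj (by rw [act_ThetaFun, AbRep.act_zero, AbRep.act_zero])
  map_add' x y := Ahat.act_inj (by simp only [act_ThetaFun, AbRep.act_add])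

theorem Theta_ofA (S : PowerSeries ℂ) :
    θ.Theta (Ahat.ofA S) = Ahat.ofA (S.subst θ.series) := by
  apply Ahat.act_inj
  change Ahat.primRep.act (θ.ThetaFun _) = _
  rw [act_ThetaFun, AbRep.act_ofA, AbRep.act_ofA, ← coe_substAlgHom θ.hasSubst]
  rfl

theorem Theta_a : θ.Theta Ahat.a = θ.alpha := by
  change θ.Theta (Ahat.ofA X) = _
  rw [Theta_ofA, subst_X θ.hasSubst]
  rfl

theorem Theta_b : θ.Theta Ahat.b = θ.beta := by
  apply Ahat.act_inj
  change Ahat.primRep.act (θ.ThetaFun _) = _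
  rw [act_ThetaFun, AbRep.act_b, act_beta]

end ChangeOfVariable

namespace AbRep

variable {ι : Type}

/-- Convergent sums `∑ g_m A^m`. -/
def powAct (A : Module.End ℂ (ι → PowerSeries ℂ)) (g : PowerSeries ℂ) :
    Module.End ℂ (ι → PowerSeries ℂ) where
  toFun v := fun j => PowerSeries.mk fun t => ∑ m ∈ Finset.range (t + 1),
    PowerSeries.coeff m g * PowerSeries.coeff t ((A ^ m) v j)
  map_add' v w := by
    funext j; ext t
    simp [Finset.sum_add_distrib, mul_add]
  map_smul' c v := by
    funext j; ext t
    simp [Finset.mul_sum, mul_left_comm]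

variable (A : Module.End ℂ (ι → PowerSeries ℂ))

theorem ord_pow (hA : ∀ t v, Ord t v → Ord (t + 1) (A v)) (n t : ℕ) (v : ι → PowerSeries ℂ)
    (hv : Ord t v) : Ord (t + n) ((A ^ n) v) := by
  induction n with
  | zero => simpa using hv
  | succ n ih =>
    rw [pow_succ', Module.End.mul_apply]
    exact hA _ _ ih

theorem coeff_powAct (hA : ∀ t v, Ord t v → Ord (t + 1) (A v)) (g : PowerSeries ℂ)
    (v : ι → PowerSeries ℂ) (j : ι) {t K : ℕ} (h : t < K) :
    PowerSeries.coeff t (powAct A g v j) = ∑ m ∈ Finset.range K,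
      PowerSeries.coeff m g * PowerSeries.coeff t ((A ^ m) v j) := by
  have h0 : powAct A g v j = PowerSeries.mk fun t => ∑ m ∈ Finset.range (t + 1),
    PowerSeries.coeff m g * PowerSeries.coeff t ((A ^ m) v j) := rfl
  rw [h0, PowerSeries.coeff_mk]
  refine Finset.sum_subset (by intro i; simp; omega) fun m _ hm => ?_
  rw [ord_pow A hA m 0 v (ord_zero v) j t (by simp at hm; omega), mul_zero]

theorem powAct_sub_ord (hA : ∀ t v, Ord t v → Ord (t + 1) (A v)) (g : PowerSeries ℂ)
    (v : ι → PowerSeries ℂ) (K : ℕ) :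
    Ord K (powAct A g v - ∑ m ∈ Finset.range K, PowerSeries.coeff m g • (A ^ m) v) := by
  intro j s hs
  simp only [Pi.sub_apply, map_sub, Finset.sum_apply, map_sum, Pi.smul_apply,
    LinearMap.map_smul, smul_eq_mul]
  rw [coeff_powAct A hA g v j hs, sub_self]

theorem ord_powAct (hA : ∀ t v, Ord t v → Ord (t + 1) (A v)) (g : PowerSeries ℂ) (t : ℕ)
    (v : ι → PowerSeries ℂ) (hv : Ord t v) : Ord t (powAct A g v) := by
  intro j s hs
  rw [coeff_powAct A hA g v j (Nat.lt_succ_self s)]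
  refine Finset.sum_eq_zero fun m _ => ?_
  rw [ord_pow A hA m t v hv j s (by omega), mul_zero]

theorem powAct_mul (hA : ∀ t v, Ord t v → Ord (t + 1) (A v)) (g h : PowerSeries ℂ) :
    powAct A (g * h) = powAct A g * powAct A h := by
  ext v j t
  have ht : t < t + 1 := Nat.lt_succ_self t
  rw [Module.End.mul_apply, coeff_powAct A hA _ v j ht, coeff_powAct A hA g _ j ht]
  have h1 : ∀ m, PowerSeries.coeff t ((A ^ m) (powAct A h v) j) =
      ∑ l ∈ Finset.range (t + 1),
        PowerSeries.coeff l h * PowerSeries.coeff t ((A ^ (m + l)) v j) := by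
    intro m
    have h2 := ord_pow A hA m _ _ (powAct_sub_ord A hA h v (t + 1)) j t (by omega)
    rw [map_sub, Pi.sub_apply, map_sub, sub_eq_zero, map_sum, Finset.sum_apply, map_sum] at h2
    rw [h2]
    refine Finset.sum_congr rfl fun l _ => ?_
    rw [LinearMap.map_smul, Pi.smul_apply, LinearMap.map_smul, smul_eq_mul, pow_add,
      Module.End.mul_apply]
  simp only [h1, Finset.mul_sum]
  rw [← Ahat.box_sum (t + 1) (fun m l => PowerSeries.coeff m g *
    (PowerSeries.coeff l h * PowerSeries.coeff t ((A ^ (m + l)) v j)))]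
  · refine Finset.sum_congr rfl fun N _ => ?_
    rw [PowerSeries.coeff_mul, Finset.sum_mul]
    refine Finset.sum_congr rfl fun p hp => ?_
    rw [Finset.HasAntidiagonal.mem_antidiagonal] at hp
    rw [hp, mul_assoc]
  · intro m l hml
    rw [ord_pow A hA (m + l) 0 v (ord_zero v) j t (by omega), mul_zero, mul_zero]

theorem powAct_C (hA : ∀ t v, Ord t v → Ord (t + 1) (A v)) (c : ℂ) :
    powAct A (C c) = c • (1 : Module.End ℂ (ι → PowerSeries ℂ)) := by
  ext v j t
  rw [coeff_powAct A hA _ v j (Nat.lt_succ_self t), Finset.sum_eq_single 0]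
  · simp
  · intro m _ hm
    simp [PowerSeries.coeff_C, hm]
  · simp

theorem powAct_X (hA : ∀ t v, Ord t v → Ord (t + 1) (A v)) : powAct A X = A := by
  refine LinearMap.ext fun v => funext fun j => PowerSeries.ext fun t => ?_
  rw [coeff_powAct A hA _ v j (show t < t + 2 by omega), Finset.sum_eq_single 1]
  · simp
  · intro m _ hm
    simp [PowerSeries.coeff_X, hm]
  · simp

theorem pair_pow (B : Module.End ℂ (ι → PowerSeries ℂ)) (hAB : A * B - B * A = B ^ 2) (m : ℕ) :
    B * A ^ (m + 1) = A ^ (m + 1) * B - (m + 1 : ℂ) • (B * A ^ m * B) := by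
  have hBA : B * A = A * B - B * B := by rw [← pow_two, ← hAB]; abel
  induction m with
  | zero => simp [hBA]
  | succ m ih =>
    have e : B * A ^ (m + 1 + 1) = (B * A ^ (m + 1)) * A := by rw [pow_succ, mul_assoc]
    have e2 : A ^ (m + 1) * (B * B) = B * A ^ (m + 1) * B + (m + 1 : ℂ) • (B * A ^ m * B * B) := by
      rw [ih, sub_mul, smul_mul_assoc]
      simp only [mul_assoc]
      abel
    rw [e, show B * A ^ (m + 1) * A = (A ^ (m + 1) * B - (m + 1 : ℂ) • (B * A ^ m * B)) * A by
      rw [ih], sub_mul, smul_mul_assoc]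
    have e3 : A ^ (m + 1) * B * A = A ^ (m + 1 + 1) * B - A ^ (m + 1) * (B * B) := by
      rw [mul_assoc, hBA, mul_sub, pow_succ A (m + 1), mul_assoc]
    have e4 : B * A ^ m * B * A = B * A ^ (m + 1) * B - B * A ^ m * B * B := by
      rw [mul_assoc, hBA, mul_sub, pow_succ A m]
      simp only [mul_assoc]
    rw [e3, e4, e2, smul_sub]
    push_cast
    module

/-- Two operators raising the order with `A B - B A = B²` define an action of `Â`: the element
`∑ p_{ν m} a^m b^ν` acts as `∑ p_{ν m} A^m B^ν`. -/
def ofPair (A B : Module.End ℂ (ι → PowerSeries ℂ))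
    (hA : ∀ t v, Ord t v → Ord (t + 1) (A v)) (hB : ∀ t v, Ord t v → Ord (t + 1) (B v))
    (hAB : A * B - B * A = B ^ 2) : AbRep ι where
  G := AlgHom.ofLinearMap
    { toFun := powAct A
      map_add' := fun g h => by
        ext v j t
        rw [LinearMap.add_apply, Pi.add_apply, map_add]
        simp only [coeff_powAct A hA _ v j (Nat.lt_succ_self t), map_add, add_mul,
          Finset.sum_add_distrib]
      map_smul' := fun c g => by
        ext v j t
        rw [LinearMap.smul_apply, Pi.smul_apply, LinearMap.map_smul]
        simp only [coeff_powAct A hA _ v j (Nat.lt_succ_self t), LinearMap.map_smul, smul_eq_mul,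
          Finset.mul_sum, mul_assoc, RingHom.id_apply] }
    (by
      have := powAct_C A hA 1
      simpa using this)
    (powAct_mul A hA)
  B := B
  hG := ord_powAct A hA
  hB := hB
  comm g v := by
    change B (powAct A g v) = powAct A g (B v) - B (powAct A (derivative ℂ g) (B v))
    funext j; ext t
    have h1 := hB _ _ (powAct_sub_ord A hA g v (t + 2)) j t (by omega)
    have h2 := hB _ _ (powAct_sub_ord A hA (derivative ℂ g) (B v) (t + 1)) j t (by omega)
    rw [map_sub, Pi.sub_apply, map_sub, sub_eq_zero, map_sum, Finset.sum_apply, map_sum] at h1 h2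
    rw [Pi.sub_apply, map_sub, h1, h2, coeff_powAct A hA g _ j (show t < t + 2 by omega),
      Finset.sum_range_succ', Finset.sum_range_succ' _ (t + 1)]
    simp only [LinearMap.map_smul, Pi.smul_apply, smul_eq_mul, pow_zero, Module.End.one_apply]
    rw [add_sub_right_comm, ← Finset.sum_sub_distrib]
    congr 1
    refine Finset.sum_congr rfl fun m _ => ?_
    have h3 := congrArg (fun T : Module.End ℂ (ι → PowerSeries ℂ) => PowerSeries.coeff t (T v j))
      (pair_pow A B hAB m)
    simp only [Module.End.mul_apply, LinearMap.sub_apply, LinearMap.smul_apply, Pi.sub_apply,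
      Pi.smul_apply, map_sub, LinearMap.map_smul, smul_eq_mul] at h3
    rw [h3, coeff_derivative]
    ring

end AbRep

/-- The free `ℂ[[b]]`-module `Ξ_λ^{(N)}` with basis `e_0, …, e_N`; an element `∑ S_j(b) e_j` is the
family of the `S_j`, and the variable `X` stands for `b`. -/
def Xi (_lam : ℚ) (N : ℕ) : Type := Fin (N + 1) → PowerSeries ℂ

namespace Xi

instance (lam : ℚ) (N : ℕ) : AddCommGroup (Xi lam N) :=
  inferInstanceAs (AddCommGroup (Fin (N + 1) → PowerSeries ℂ))

/-- The coefficient `S_{j+1}`, or `0` when `j = N`. -/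
def next (N : ℕ) (j : Fin (N + 1)) : (Fin (N + 1) → PowerSeries ℂ) →ₗ[ℂ] PowerSeries ℂ :=
  if h : (j : ℕ) + 1 < N + 1 then LinearMap.proj ⟨j + 1, h⟩ else 0

/-- The operator `a`: since `a S(b) = S(b) a + b² S'(b)`, `a e_0 = λ b e_0` and
`a e_j = λ b e_j + b e_{j-1}`, the coefficient of `e_j` in `a ∑ S_i e_i` is
`b² S_j' + λ b S_j + b S_{j+1}`. -/
def aOp (lam : ℚ) (N : ℕ) : Module.End ℂ (Fin (N + 1) → PowerSeries ℂ) where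
  toFun v := fun j => X ^ 2 * derivative ℂ (v j) + (lam : ℂ) • (X * v j) + X * next N j v
  map_add' v w := by
    funext j
    simp only [Pi.add_apply, map_add, mul_add, smul_add]
    abel
  map_smul' c v := by
    funext j
    simp only [Pi.smul_apply, map_smul, Derivation.map_smul, mul_smul_comm, RingHom.id_apply,
      smul_add, smul_comm c (lam : ℂ)]

/-- The operator `b`. -/
def bOp (N : ℕ) : Module.End ℂ (Fin (N + 1) → PowerSeries ℂ) :=
  Algebra.lsmul ℂ ℂ (Fin (N + 1) → PowerSeries ℂ) (X : PowerSeries ℂ)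

theorem ord_next (N t : ℕ) (v : Fin (N + 1) → PowerSeries ℂ) (hv : AbRep.Ord t v)
    (j : Fin (N + 1)) (s : ℕ) (hs : s < t) : PowerSeries.coeff s (next N j v) = 0 := by
  unfold next
  split_ifs with h
  · exact hv _ s hs
  · simp

theorem ord_aOp (lam : ℚ) (N t : ℕ) (v : Fin (N + 1) → PowerSeries ℂ) (hv : AbRep.Ord t v) :
    AbRep.Ord (t + 1) (aOp lam N v) := by
  intro j s hs
  change PowerSeries.coeff s (X ^ 2 * derivative ℂ (v j) + (lam : ℂ) • (X * v j) +
    X * next N j v) = 0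
  rcases s with _ | s
  · simp
  · have h1 : PowerSeries.coeff s (v j) = 0 := hv j s (by omega)
    have h2 := ord_next N t v hv j s (by omega)
    have h3 : PowerSeries.coeff s (X * derivative ℂ (v j)) = 0 := by
      rcases s with _ | s
      · simp
      · rw [PowerSeries.coeff_succ_X_mul, coeff_derivative, hv j _ (by omega), zero_mul]
    rw [map_add, map_add, LinearMap.map_smul, pow_two, mul_assoc, PowerSeries.coeff_succ_X_mul,
      PowerSeries.coeff_succ_X_mul, PowerSeries.coeff_succ_X_mul, h1, h2, h3]
    simp

theorem ord_bOp (N t : ℕ) (v : Fin (N + 1) → PowerSeries ℂ) (hv : AbRep.Ord t v) :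
    AbRep.Ord (t + 1) (bOp N v) := by
  intro j s hs
  change PowerSeries.coeff s (X * v j) = 0
  rcases s with _ | s
  · simp
  · rw [PowerSeries.coeff_succ_X_mul, hv j s (by omega)]

theorem next_X_mul (N : ℕ) (j : Fin (N + 1)) (v : Fin (N + 1) → PowerSeries ℂ) :
    next N j (bOp N v) = X * next N j v := by
  unfold next
  split_ifs
  · rfl
  · simp

theorem aOp_bOp (lam : ℚ) (N : ℕ) : aOp lam N * bOp N - bOp N * aOp lam N = bOp N ^ 2 := by
  refine LinearMap.ext fun v => funext fun j => ?_
  rw [LinearMap.sub_apply, Module.End.mul_apply, Module.End.mul_apply, pow_two,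
    Module.End.mul_apply, Pi.sub_apply]
  change (X ^ 2 * derivative ℂ (X * v j) + (lam : ℂ) • (X * (X * v j)) + X * next N j (bOp N v)) -
    X * (X ^ 2 * derivative ℂ (v j) + (lam : ℂ) • (X * v j) + X * next N j v) = X * (X * v j)
  rw [next_X_mul, Derivation.leibniz, derivative_X, smul_eq_mul, smul_eq_mul]
  simp only [PowerSeries.smul_eq_C_mul]
  ring

/-- The action of `Â` on `Ξ_λ^{(N)}` given by the operators `a` and `b`. -/
def rep (lam : ℚ) (N : ℕ) : AbRep (Fin (N + 1)) :=
  AbRep.ofPair (aOp lam N) (bOp N) (ord_aOp lam N) (ord_bOp N) (aOp_bOp lam N)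

instance (lam : ℚ) (N : ℕ) : Module Ahat (Xi lam N) :=
  Module.compHom (Fin (N + 1) → PowerSeries ℂ) (rep lam N).hom

theorem a_smul (lam : ℚ) (N : ℕ) (v : Xi lam N) : Ahat.a • v = aOp lam N v := by
  change (rep lam N).act (Ahat.ofA X) v = _
  rw [AbRep.act_ofA]
  exact congrArg (fun T : Module.End ℂ (Fin (N + 1) → PowerSeries ℂ) => T v)
    (AbRep.powAct_X _ (ord_aOp lam N))

theorem ofB_smul (lam : ℚ) (N : ℕ) (S : PowerSeries ℂ) (v : Xi lam N) :
    Ahat.ofB S • v = fun j => S * v j := by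
  change (rep lam N).act (Ahat.ofB S) v = _
  funext j; ext t
  have h1 : ∀ n, ((bOp N) ^ n) v j = X ^ n * v j := by
    intro n
    rw [bOp, ← map_pow]
    rfl
  rw [AbRep.coeff_act _ _ v j (Nat.lt_succ_self t), PowerSeries.coeff_mul,
    Finset.Nat.sum_antidiagonal_eq_sum_range_succ
      (fun k l => PowerSeries.coeff k S * PowerSeries.coeff l (v j))]
  refine Finset.sum_congr rfl fun n hn => ?_
  change PowerSeries.coeff t (AbRep.powAct (aOp lam N) (C (PowerSeries.coeff n S))
    (((bOp N) ^ n) v) j) = _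
  rw [AbRep.powAct_C _ (ord_aOp lam N), LinearMap.smul_apply, Pi.smul_apply, LinearMap.map_smul,
    Module.End.one_apply, h1, PowerSeries.coeff_X_pow_mul', if_pos (by simp at hn; omega),
    smul_eq_mul]

/-- The basis vector `e_j`. -/
def e (lam : ℚ) (N : ℕ) (j : Fin (N + 1)) : Xi lam N :=
  (Pi.single j 1 : Fin (N + 1) → PowerSeries ℂ)

theorem b_smul_apply (lam : ℚ) (N : ℕ) (v : Xi lam N) (i : Fin (N + 1)) :
    (Ahat.b • v : Xi lam N) i = X * v i := congrFun (ofB_smul lam N X v) i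

theorem a_smul_e_zero (lam : ℚ) (N : ℕ) :
    Ahat.a • e lam N 0 = Ahat.scalar lam • Ahat.b • e lam N 0 := by
  rw [a_smul, Ahat.scalar, RingHom.comp_apply, ofB_smul]
  funext i
  rw [b_smul_apply]
  change X ^ 2 * derivative ℂ ((Pi.single 0 1 : Fin (N + 1) → PowerSeries ℂ) i) +
    (lam : ℂ) • (X * (Pi.single 0 1 : Fin (N + 1) → PowerSeries ℂ) i) +
    X * next N i (Pi.single 0 1) = C (lam : ℂ) * (X * (Pi.single 0 1 : Fin (N + 1) → _) i)
  have h1 : next N i (Pi.single 0 1) = 0 := by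
    unfold next
    split_ifs with h
    · change (Pi.single 0 1 : Fin (N + 1) → PowerSeries ℂ) ⟨(i : ℕ) + 1, h⟩ = 0
      refine Pi.single_eq_of_ne (M := fun _ : Fin (N + 1) => PowerSeries ℂ) (fun h0 => ?_) _
      have := congrArg Fin.val h0
      simp at this
    · rfl
  rw [h1, PowerSeries.smul_eq_C_mul, Pi.single_apply]
  split_ifs <;> simp

theorem a_smul_e_succ (lam : ℚ) (N : ℕ) (j : Fin N) :
    Ahat.a • e lam N j.succ =
      Ahat.scalar lam • Ahat.b • e lam N j.succ + Ahat.b • e lam N j.castSucc := by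
  rw [a_smul, Ahat.scalar, RingHom.comp_apply, ofB_smul]
  funext i
  change X ^ 2 * derivative ℂ ((Pi.single j.succ 1 : Fin (N + 1) → PowerSeries ℂ) i) +
    (lam : ℂ) • (X * (Pi.single j.succ 1 : Fin (N + 1) → PowerSeries ℂ) i) +
    X * next N i (Pi.single j.succ 1) = C (lam : ℂ) * ((Ahat.b • e lam N j.succ : Xi lam N) i) +
      (Ahat.b • e lam N j.castSucc : Xi lam N) i
  rw [b_smul_apply, b_smul_apply]
  have h1 : next N i (Pi.single j.succ 1) = e lam N j.castSucc i := by
    change _ = (Pi.single j.castSucc 1 : Fin (N + 1) → PowerSeries ℂ) i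
    unfold next
    split_ifs with h
    · simp [Pi.single_apply, Fin.ext_iff]
    · have : i ≠ j.castSucc := by
        rintro rfl
        simp at h
      simp [this]
  rw [h1, PowerSeries.smul_eq_C_mul]
  change X ^ 2 * derivative ℂ ((Pi.single j.succ 1 : Fin (N + 1) → PowerSeries ℂ) i) +
    _ * (X * (Pi.single j.succ 1 : Fin (N + 1) → PowerSeries ℂ) i) + _ =
    _ * (X * (Pi.single j.succ 1 : Fin (N + 1) → PowerSeries ℂ) i) + _
  rw [Pi.single_apply]
  split_ifs <;> simp

end Xi

/-- `θ_*(E)`: the additive group `E` on which `x ∈ Â` acts as `Θ(x)`. -/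
def ChangeVar (_θ : ChangeOfVariable) (E : Type*) : Type _ := E

namespace ChangeVar

variable (θ : ChangeOfVariable) (E : Type*) [AddCommGroup E]

instance : AddCommGroup (ChangeVar θ E) := inferInstanceAs (AddCommGroup E)

instance [Module Ahat E] : Module Ahat (ChangeVar θ E) := Module.compHom E θ.Theta

/-- The identity map `E → θ_*(E)`. -/
def of : E ≃+ ChangeVar θ E := AddEquiv.refl E

theorem smul_of [Module Ahat E] (x : Ahat) (e : E) : x • of θ E e = of θ E (θ.Theta x • e) := rfl

end ChangeVar

namespace ABModule

universe u

section

variable (E : Type u) [AddCommGroup E] [Module Ahat E]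

/-- The underlying `ℂ[[b]]`-module of an `Â`-module. -/
abbrev seriesModule : Module (PowerSeries ℂ) E := Module.compHom E Ahat.ofB

/-- The underlying `ℂ`-vector space of an `Â`-module. -/
abbrev complexModule : Module ℂ E := Module.compHom E Ahat.scalar

/-- `E` is free over `ℂ[[b]]`. -/
def IsFree : Prop :=
  letI := seriesModule E
  Module.Free (PowerSeries ℂ) E

/-- `E` is finitely generated over `ℂ[[b]]`. -/
def IsFinite : Prop :=
  letI := seriesModule E
  Module.Finite (PowerSeries ℂ) E

/-- The rank of `E` over `ℂ[[b]]`. -/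
def rank : ℕ :=
  letI := seriesModule E
  Module.finrank (PowerSeries ℂ) E

/-- Simple pole (a,b)-modules. -/
def IsSimplePole : Prop :=
  IsFree E ∧ IsFinite E ∧ ∀ x : E, ∃ y : E, Ahat.a • x = Ahat.b • y

/-- Regular (a,b)-modules: those contained in a simple pole (a,b)-module. -/
def IsRegular : Prop :=
  ∃ (F : Type u) (_ : AddCommGroup F) (_ : Module Ahat F) (i : E →ₗ[Ahat] F),
    IsSimplePole F ∧ Function.Injective i

variable {E}

/-- `i` exhibits `F` as the saturation `E^♯`, the smallest simple pole (a,b)-module containing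
`E`. -/
def IsSaturation {F : Type u} [AddCommGroup F] [Module Ahat F] (i : E →ₗ[Ahat] F) : Prop :=
  IsSimplePole F ∧ Function.Injective i ∧
    ∀ G : Submodule Ahat F, LinearMap.range i ≤ G →
      (∀ x ∈ G, ∃ y ∈ G, Ahat.a • x = Ahat.b • y) → G = ⊤

variable (E)

attribute [local instance] complexModule

/-- Multiplication by `x ∈ Â` as a `ℂ`-linear map. -/
def mulLeft (x : Ahat) : E →ₗ[ℂ] E where
  toFun e := x • e
  map_add' := smul_add x
  map_smul' c e := by
    change x • (Ahat.scalar c • e) = Ahat.scalar c • (x • e)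
    rw [← mul_smul, ← mul_smul, Ahat.scalar_comm]

/-- `B` is the Bernstein polynomial of the regular (a,b)-module `E`: the minimal polynomial of
`-b⁻¹a` acting on `E^♯ / b E^♯`. Here `T` is the endomorphism induced by `b⁻¹a`. -/
def IsBernsteinPolynomial (B : Polynomial ℂ) : Prop :=
  ∃ (F : Type u) (_ : AddCommGroup F) (_ : Module Ahat F) (i : E →ₗ[Ahat] F)
    (T : Module.End ℂ (F ⧸ LinearMap.range (mulLeft F Ahat.b))),
    IsSaturation i ∧
    (∀ x y : F, Ahat.a • x = Ahat.b • y →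
      T (Submodule.Quotient.mk x) = Submodule.Quotient.mk y) ∧
    B = minpoly ℂ (-T)

/-- The dimension of `Ker (a - μ b) : E → E`. -/
def kerDim (μ : ℂ) : ℕ :=
  Module.finrank ℂ (LinearMap.ker (mulLeft E (Ahat.a - Ahat.scalar μ * Ahat.b)))

/-- Geometric (a,b)-modules: regular, with negative rational roots of the Bernstein polynomial. -/
def IsGeometric : Prop :=
  IsRegular E ∧ ∃ B, IsBernsteinPolynomial E B ∧
    ∀ z : ℂ, B.IsRoot z → ∃ q : ℚ, q < 0 ∧ z = (q : ℂ)

/-- Frescos: geometric (a,b)-modules generated by one element over `Â`. -/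
def IsFresco : Prop :=
  IsGeometric E ∧ ∃ e : E, Submodule.span Ahat {e} = ⊤

/-- `[λ]`-primitive frescos: all roots of the Bernstein polynomial lie in `-[λ] = -λ + ℤ`. -/
def IsPrimitiveFresco (lam : ℚ) : Prop :=
  IsFresco E ∧ ∃ B, IsBernsteinPolynomial E B ∧
    ∀ z : ℂ, B.IsRoot z → ∃ n : ℤ, z = -((lam : ℂ) + (n : ℂ))

/-- `[λ]`-primitive themes: frescos that embed in some `Ξ_λ^{(N)}`. -/
def IsTheme (lam : ℚ) : Prop :=
  IsPrimitiveFresco E lam ∧ ∃ (N : ℕ) (φ : E →ₗ[Ahat] Xi lam N), Function.Injective φ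

/-- Semi-simple `[λ]`-primitive frescos: every `Â`-linear map to a `Ξ_λ^{(N)}` has rank `≤ 1`. -/
def IsSemisimpleFresco (lam : ℚ) : Prop :=
  IsPrimitiveFresco E lam ∧ ∀ (N : ℕ) (φ : E →ₗ[Ahat] Xi lam N), rank (LinearMap.range φ) ≤ 1

variable {E} in
/-- Normal submodules. -/
def IsNormal (F : Submodule Ahat E) : Prop := IsFree (E ⧸ F)

/-- `S_1(E)`: the biggest semi-simple submodule. -/
def S1 (lam : ℚ) : Submodule Ahat E := sSup {F | IsSemisimpleFresco F lam}

/-- `Σ^1(E)`: the smallest normal submodule with semi-simple quotient. -/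
def Sigma1 (lam : ℚ) : Submodule Ahat E :=
  sInf {F | IsNormal F ∧ IsSemisimpleFresco (E ⧸ F) lam}

/-- The ss-depth `d(E)`: the maximal rank of a normal sub-theme. -/
def ssDepth (lam : ℚ) : ℕ :=
  sSup {r | ∃ F : Submodule Ahat E, IsNormal F ∧ IsTheme F lam ∧ rank F = r}

/-- `δ(E)`: the common value of `dim Ker (a - μ b)` for all large enough `μ ∈ [λ] = λ + ℤ`. -/
def delta (lam : ℚ) : ℕ :=
  sInf {r | ∃ M : ℚ, ∀ n : ℤ, M ≤ lam + n → kerDim E ((lam : ℂ) + (n : ℂ)) = r}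

end

end ABModule

end

/-! Passing from `E` to `θ_*(E)` replaces a by α = θ(a) and b by β = b θ'(a). Since θ(a)/a and θ'(a)
are units of ℂ[[a]], α and β differ from a and b only by unit factors on the right. Compositional
inversion of θ makes Θ an automorphism of Â. `Twist` records an identification of E' with `θ_*(E)`
in a symmetric form: a twist for θ has an inverse twist for the inverse series, and it restricts to
submodules and passes to quotients. Each property therefore needs transporting in one direction
only, and submodules of `E` and of `θ_*(E)` form the same lattice.

Being free of finite rank over ℂ[[b]] is not visibly preserved, because b changes. `IsBasisB`
rephrases it by injectivity of b, b-adic separation and a basis of E/bE, all of which tolerate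
replacing b by β (`Twist.isBasisB`). The same unit argument preserves simple poles and saturations.
On F/bF, where aF ⊂ bF, a series S(a) acts as S(0); as θ(a)/a and θ'(a) have the same constant term
θ'(0), the operator b⁻¹a on F/bF is unchanged, and so is the Bernstein polynomial.

For themes, semi-simplicity and δ, let a act as multiplication by s and b as integration. A solution
of a x = μ b x behaves like s^{μ-1}, and e_j in Ξ_λ like s^{λ-1}(log s)^j/j!. Substituting θ(s) for
s multiplies the first by (θ(s)/s)^{μ-1} and adds log(θ(s)/s) to the logarithm. Realised by series
in a, and normalised to drop the constants coming from θ'(0), this gives injections between the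
kernels of a - μb (`Twist.exists_ker_injective`) and an embedding of Ξ_λ in θ_*(Ξ_λ)
(`Xi.exists_pullback`). Composing with the latter, for θ or its inverse, carries maps to Ξ_λ across
a twist with the same rank. The assertions on S_1, Σ^1 and d follow because their defining families
of submodules correspond; δ follows from equality of all the kernel dimensions. -/

noncomputable section

open PowerSeries

/-! ### Division by b in Â -/

namespace Ahat

theorem coeff_sub (x y : Ahat) (n : ℕ) : (x - y).coeff n = x.coeff n - y.coeff n := rfl

/-- The quotient of the division on the right by `b`. -/
def divB (x : Ahat) : Ahat := fun n => x.coeff (n + 1)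

theorem coeff_divB (x : Ahat) (n : ℕ) : (divB x).coeff n = x.coeff (n + 1) := rfl

theorem coeff_ofA (S : PowerSeries ℂ) (n : ℕ) : (ofA S).coeff n = if n = 0 then S else 0 := rfl

theorem eq_ofA_add_divB_mul_b (x : Ahat) : x = ofA (x.coeff 0) + divB x * b := by
  ext1 n
  rw [coeff_add, coeff_mul_b, coeff_ofA]
  rcases n with _ | n
  · simp
  · simp [coeff_divB]

theorem ofA_eq (S : PowerSeries ℂ) :
    ofA S = scalar (constantCoeff S) + ofA (mk fun p => PowerSeries.coeff (p + 1) S) * a := by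
  rw [scalar_eq, show a = ofA X from rfl, ← map_mul, ← map_add, add_comm,
    ← eq_shift_mul_X_add_const]

theorem exists_eq_scalar_add (x : Ahat) :
    ∃ (c : ℂ) (y z : Ahat), x = scalar c + y * a + z * b :=
  ⟨_, _, _, by rw [← ofA_eq]; exact eq_ofA_add_divB_mul_b x⟩

theorem b_mul_ofA (S : PowerSeries ℂ) :
    b * ofA S = ofA S * b - b * ofA (derivative ℂ S) * b := by
  apply act_inj
  change primRep.hom _ = primRep.hom _
  simp only [map_sub, map_mul]
  change primRep.act b * primRep.act (ofA S) = primRep.act (ofA S) * primRep.act b -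
    primRep.act b * primRep.act (ofA (derivative ℂ S)) * primRep.act b
  rw [AbRep.act_ofA, AbRep.act_ofA, AbRep.act_b]
  refine LinearMap.ext fun v => ?_
  exact primRep.comm S v

theorem coeff_b_mul_zero (x : Ahat) : (b * x).coeff 0 = 0 := by
  rw [coeff_mul]
  simp [b, coeff_ofBFun]

/-- Coefficientwise derivation with respect to `a`. -/
def dA (x : Ahat) : Ahat := fun n => derivative ℂ (x.coeff n)

/-- This is b x = x b - b x' b read coefficientwise, where ' differentiates the coefficients and b
x' = (b x)'. It computes left multiplication by b recursively, avoiding the binomial product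
formula. -/
theorem coeff_b_mul_succ (x : Ahat) (N : ℕ) :
    (b * x).coeff (N + 1) = x.coeff N - derivative ℂ ((b * x).coeff N) := by
  induction N generalizing x with
  | zero =>
    rw [coeff_b_mul_zero]
    conv_lhs => rw [eq_ofA_add_divB_mul_b x, mul_add, b_mul_ofA, ← mul_assoc]
    rw [coeff_add, coeff_sub, coeff_mul_b, coeff_mul_b, coeff_mul_b]
    simp [coeff_ofA, coeff_b_mul_zero]
  | succ N ih =>
    conv_lhs => rw [eq_ofA_add_divB_mul_b x, mul_add, b_mul_ofA, ← mul_assoc]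
    conv_rhs => rw [eq_ofA_add_divB_mul_b x, mul_add, b_mul_ofA, ← mul_assoc]
    simp only [coeff_add, coeff_sub, coeff_mul_b, coeff_ofA]
    simp only [Nat.add_sub_cancel, if_neg (Nat.succ_ne_zero _), zero_sub, zero_add]
    rw [ih (divB x)]
    rcases N with _ | N
    · simp only [ih, coeff_b_mul_zero, coeff_ofA, if_pos, map_zero, sub_zero, map_add, zero_add]
      abel
    · simp only [ih, coeff_ofA, if_neg (Nat.succ_ne_zero _), zero_sub, map_add, map_neg]
      abel

/-- The relation S(a) b = b S(a) + b S'(a) b gives the witness x + x' b. Hence Âb ⊂ bÂ, so b^n E is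
stable under Â for every module E. -/
theorem exists_mul_b_eq (x : Ahat) : ∃ y, x * b = b * y := by
  refine ⟨x + dA x * b, ?_⟩
  ext1 n
  induction n with
  | zero => rw [coeff_mul_b, coeff_b_mul_zero]; rfl
  | succ n ih =>
    rw [coeff_b_mul_succ, ← ih, coeff_mul_b, coeff_add, coeff_mul_b, coeff_mul_b]
    rcases n with _ | n
    · simp
    · simp [dA, coeff]

theorem exists_mul_b_pow_eq (x : Ahat) (n : ℕ) : ∃ y, x * b ^ n = b ^ n * y := by
  induction n generalizing x with
  | zero => exact ⟨x, by simp⟩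
  | succ n ih =>
    obtain ⟨y, hy⟩ := exists_mul_b_eq x
    obtain ⟨z, hz⟩ := ih y
    exact ⟨z, by rw [pow_succ', ← mul_assoc, hy, mul_assoc, hz, mul_assoc]⟩

/-- No continuity is needed: writing x = P(a) + y b gives ρ x - x = (ρ y - y) b, so the difference
is divisible on the right by every power of b. -/
theorem ringHom_ext_of_ofA_of_b (ρ : Ahat →+* Ahat) (hA : ∀ S, ρ (ofA S) = ofA S)
    (hb : ρ b = b) (x : Ahat) : ρ x = x := by
  have key : ∀ K, ∀ x, ∀ i < K, (ρ x - x).coeff i = 0 := by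
    intro K
    induction K with
    | zero => intro x i hi; omega
    | succ K ih =>
      intro x i hi
      have h : ρ x - x = (ρ (divB x) - divB x) * b := by
        conv_lhs => rw [eq_ofA_add_divB_mul_b x]
        rw [map_add, map_mul, hA, hb]
        noncomm_ring
      rw [h, coeff_mul_b]
      split_ifs with h0
      · rfl
      · exact ih _ _ (by omega)
  exact sub_eq_zero.1 (ext fun n => key (n + 1) x n (by omega))

end Ahat

/-! ### The inverse change of variable, and α, β compared with a, b -/

namespace ChangeOfVariable

variable (θ : ChangeOfVariable)

theorem isUnit_coeff_one : IsUnit (PowerSeries.coeff 1 θ.series) := θ.deriv_ne_zero.isUnit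

/-- The compositional inverse. -/
def symm : ChangeOfVariable where
  series := θ.series.substInvOfIsUnit θ.isUnit_coeff_one
  zero := constantCoeff_substInvOfIsUnit ..
  deriv_ne_zero := by
    rw [coeff_one_substInvOfIsUnit]
    exact Units.ne_zero _

theorem series_subst_symm : θ.series.subst θ.symm.series = X :=
  subst_substInvOfIsUnit_right _ θ.zero _

theorem symm_series_subst : θ.symm.series.subst θ.series = X :=
  subst_substInvOfIsUnit_left _ θ.zero _

/-- On b this is the chain rule: b is sent to b θ'(a) η'(θ(a)) = b (η ∘ θ)'(a) = b. -/
theorem Theta_Theta {η : ChangeOfVariable} (h : η.series.subst θ.series = X) (x : Ahat) :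
    θ.Theta (η.Theta x) = x := by
  refine Ahat.ringHom_ext_of_ofA_of_b (θ.Theta.comp η.Theta) (fun S => ?_) ?_ x
  · rw [RingHom.comp_apply, Theta_ofA, Theta_ofA, subst_comp_subst_apply η.hasSubst θ.hasSubst, h,
      X_subst]
  · rw [RingHom.comp_apply, Theta_b, beta, map_mul, Theta_b, Theta_ofA, beta, mul_assoc,
      ← map_mul]
    have h1 := congrArg (derivative ℂ) h
    rw [derivative_subst θ.hasSubst, derivative_X] at h1
    rw [mul_comm, h1, map_one, mul_one]

theorem Theta_symm_Theta (x : Ahat) : θ.symm.Theta (θ.Theta x) = x :=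
  θ.symm.Theta_Theta θ.series_subst_symm x

theorem Theta_Theta_symm (x : Ahat) : θ.Theta (θ.symm.Theta x) = x :=
  θ.Theta_Theta θ.symm_series_subst x

theorem Theta_scalar (c : ℂ) : θ.Theta (Ahat.scalar c) = Ahat.scalar c := by
  rw [Ahat.scalar_eq, Theta_ofA, subst_C]
  rfl

/-- The series `θ(a) / a`. -/
def quot : PowerSeries ℂ := PowerSeries.mk fun p => PowerSeries.coeff (p + 1) θ.series

theorem series_eq : θ.series = X * θ.quot := by
  have := eq_X_mul_shift_add_const θ.series
  rwa [θ.zero, map_zero, add_zero] at this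

theorem constantCoeff_quot : constantCoeff θ.quot = PowerSeries.coeff 1 θ.series := by
  rw [← coeff_zero_eq_constantCoeff_apply, quot, coeff_mk]

theorem constantCoeff_derivative :
    constantCoeff (derivative ℂ θ.series) = PowerSeries.coeff 1 θ.series := by
  rw [← coeff_zero_eq_constantCoeff_apply, coeff_derivative]
  simp

theorem quot_mul_inv : θ.quot * θ.quot⁻¹ = 1 :=
  PowerSeries.mul_inv_cancel _ (by rw [constantCoeff_quot]; exact θ.deriv_ne_zero)

theorem derivative_mul_inv : derivative ℂ θ.series * (derivative ℂ θ.series)⁻¹ = 1 :=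
  PowerSeries.mul_inv_cancel _ (by rw [constantCoeff_derivative]; exact θ.deriv_ne_zero)

theorem alpha_eq : θ.alpha = Ahat.a * Ahat.ofA θ.quot := by
  rw [alpha, series_eq, map_mul]; rfl

theorem a_eq : Ahat.a = θ.alpha * Ahat.ofA θ.quot⁻¹ := by
  rw [alpha_eq, mul_assoc, ← map_mul, quot_mul_inv, map_one, mul_one]

theorem b_eq : Ahat.b = θ.beta * Ahat.ofA (derivative ℂ θ.series)⁻¹ := by
  rw [beta, mul_assoc, ← map_mul, derivative_mul_inv, map_one, mul_one]

/-- The factors θ'(a) can be moved to the right past powers of b. Thus β^n E ⊂ b^n E, which is what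
transports b-adic separation. -/
theorem exists_beta_pow_eq (n : ℕ) : ∃ x, θ.beta ^ n = Ahat.b ^ n * x := by
  induction n with
  | zero => exact ⟨1, by simp⟩
  | succ n ih =>
    obtain ⟨x, hx⟩ := ih
    obtain ⟨y, hy⟩ := Ahat.exists_mul_b_pow_eq (Ahat.ofA (derivative ℂ θ.series)) n
    exact ⟨y * x, by rw [pow_succ', pow_succ', hx, beta, ← mul_assoc, mul_assoc Ahat.b, hy,
      ← mul_assoc, ← mul_assoc]⟩

end ChangeOfVariable

/-! ### Twisted equivalences, their inverses, restrictions and quotients -/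

/-- An additive equivalence `E ≃ E'` that identifies `E'` with `θ_*(E)`. -/
structure Twist (θ : ChangeOfVariable) (E E' : Type*) [AddCommGroup E] [Module Ahat E]
    [AddCommGroup E'] [Module Ahat E'] extends E ≃+ E' where
  map_Theta_smul' : ∀ (x : Ahat) (e : E), toFun (θ.Theta x • e) = x • toFun e

namespace Twist

variable {θ : ChangeOfVariable} {E E' : Type*} [AddCommGroup E] [Module Ahat E]
  [AddCommGroup E'] [Module Ahat E'] (f : Twist θ E E')

theorem map_Theta_smul (x : Ahat) (e : E) :
    f.toAddEquiv (θ.Theta x • e) = x • f.toAddEquiv e := f.map_Theta_smul' x e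

theorem map_smul (x : Ahat) (e : E) :
    f.toAddEquiv (x • e) = θ.symm.Theta x • f.toAddEquiv e := by
  rw [← map_Theta_smul, θ.Theta_Theta_symm]

theorem map_scalar_smul (c : ℂ) (e : E) :
    f.toAddEquiv (Ahat.scalar c • e) = Ahat.scalar c • f.toAddEquiv e := by
  rw [← map_Theta_smul, θ.Theta_scalar]

theorem map_beta_smul (e : E) : f.toAddEquiv (θ.beta • e) = Ahat.b • f.toAddEquiv e := by
  rw [← map_Theta_smul, θ.Theta_b]

theorem map_beta_pow_smul (n : ℕ) (e : E) :
    f.toAddEquiv (θ.beta ^ n • e) = Ahat.b ^ n • f.toAddEquiv e := by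
  rw [← map_Theta_smul, map_pow, θ.Theta_b]

theorem map_alpha_smul (e : E) : f.toAddEquiv (θ.alpha • e) = Ahat.a • f.toAddEquiv e := by
  rw [← map_Theta_smul, θ.Theta_a]

theorem map_b_smul (e : E) : f.toAddEquiv (Ahat.b • e) =
    Ahat.b • f.toAddEquiv (Ahat.ofA (derivative ℂ θ.series)⁻¹ • e) := by
  rw [← map_beta_smul, ← mul_smul, ← θ.b_eq]

theorem symm_smul (x : Ahat) (e : E') :
    f.toAddEquiv.symm (x • e) = θ.Theta x • f.toAddEquiv.symm e := by
  apply f.toAddEquiv.injective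
  rw [map_Theta_smul, AddEquiv.apply_symm_apply, AddEquiv.apply_symm_apply]

/-- The inverse equivalence, which belongs to the inverse change of variable. -/
def symm : Twist θ.symm E' E where
  toAddEquiv := f.toAddEquiv.symm
  map_Theta_smul' x e := by
    change f.toAddEquiv.symm (θ.symm.Theta x • e) = x • f.toAddEquiv.symm e
    rw [symm_smul, θ.Theta_Theta_symm]

/-- The submodule of `E'` with the same elements as `F`. -/
def mapSubmodule (F : Submodule Ahat E) : Submodule Ahat E' where
  carrier := {y | f.toAddEquiv.symm y ∈ F}
  add_mem' hx hy := by
    rw [Set.mem_ofPred_eq, map_add]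
    exact F.add_mem hx hy
  zero_mem' := by
    change f.toAddEquiv.symm 0 ∈ F
    rw [map_zero]
    exact F.zero_mem
  smul_mem' x _ hy := by
    rw [Set.mem_ofPred_eq, symm_smul]
    exact F.smul_mem _ hy

theorem mem_mapSubmodule {F : Submodule Ahat E} {y : E'} :
    y ∈ f.mapSubmodule F ↔ f.toAddEquiv.symm y ∈ F := Iff.rfl

theorem apply_mem_mapSubmodule {F : Submodule Ahat E} {x : E} :
    f.toAddEquiv x ∈ f.mapSubmodule F ↔ x ∈ F := by
  rw [mem_mapSubmodule, AddEquiv.symm_apply_apply]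

theorem symm_mapSubmodule_mapSubmodule (F : Submodule Ahat E) :
    f.symm.mapSubmodule (f.mapSubmodule F) = F := by
  ext x
  exact f.apply_mem_mapSubmodule

theorem mapSubmodule_symm_mapSubmodule (F : Submodule Ahat E') :
    f.mapSubmodule (f.symm.mapSubmodule F) = F := by
  ext x
  change f.toAddEquiv (f.toAddEquiv.symm x) ∈ F ↔ _
  rw [AddEquiv.apply_symm_apply]

/-- Submodules of `E` and of `θ_*(E)` are the same. -/
def submoduleOrderIso : Submodule Ahat E ≃o Submodule Ahat E' where
  toFun := f.mapSubmodule
  invFun := f.symm.mapSubmodule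
  left_inv := f.symm_mapSubmodule_mapSubmodule
  right_inv := f.mapSubmodule_symm_mapSubmodule
  map_rel_iff' {F G} := by
    refine ⟨fun h x hx => ?_, fun h y hy => h hy⟩
    exact f.apply_mem_mapSubmodule.1 (h (f.apply_mem_mapSubmodule.2 hx))

/-- The restriction to a submodule. -/
def restrict (F : Submodule Ahat E) : Twist θ F (f.mapSubmodule F) where
  toFun x := ⟨f.toAddEquiv x, f.apply_mem_mapSubmodule.2 x.2⟩
  invFun y := ⟨f.toAddEquiv.symm y, y.2⟩
  left_inv _ := Subtype.ext (f.toAddEquiv.symm_apply_apply _)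
  right_inv _ := Subtype.ext (f.toAddEquiv.apply_symm_apply _)
  map_add' _ _ := Subtype.ext (map_add f.toAddEquiv _ _)
  map_Theta_smul' x e := Subtype.ext (f.map_Theta_smul x e)

/-- The equivalence induced on a quotient. -/
def quotient (F : Submodule Ahat E) : Twist θ (E ⧸ F) (E' ⧸ f.mapSubmodule F) where
  toAddEquiv := QuotientAddGroup.congr F.toAddSubgroup (f.mapSubmodule F).toAddSubgroup
    f.toAddEquiv (by
      ext y
      constructor
      · rintro ⟨x, hx, rfl⟩
        exact f.apply_mem_mapSubmodule.2 hx
      · intro hy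
        exact ⟨f.toAddEquiv.symm y, hy, f.toAddEquiv.apply_symm_apply y⟩)
  map_Theta_smul' x e := by
    induction e using Submodule.Quotient.induction_on with
    | H e => exact congrArg (Submodule.Quotient.mk (p := f.mapSubmodule F)) (f.map_Theta_smul x e)

/-- The linear map `θ_*(E) → θ_*(F)` with the same underlying map as `i : E → F`. -/
def mapLinear {F F' : Type*} [AddCommGroup F] [Module Ahat F] [AddCommGroup F'] [Module Ahat F']
    (g : Twist θ F F') (i : E →ₗ[Ahat] F) : E' →ₗ[Ahat] F' where
  toFun y := g.toAddEquiv (i (f.toAddEquiv.symm y))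
  map_add' x y := by simp only [map_add]
  map_smul' x y := by
    rw [symm_smul, LinearMap.map_smul, map_Theta_smul, RingHom.id_apply]

theorem mapLinear_apply {F F' : Type*} [AddCommGroup F] [Module Ahat F] [AddCommGroup F']
    [Module Ahat F'] (g : Twist θ F F') (i : E →ₗ[Ahat] F) (x : E) :
    f.mapLinear g i (f.toAddEquiv x) = g.toAddEquiv (i x) := by
  change g.toAddEquiv (i (f.toAddEquiv.symm (f.toAddEquiv x))) = _
  rw [AddEquiv.symm_apply_apply]

theorem mapLinear_injective {F F' : Type*} [AddCommGroup F] [Module Ahat F] [AddCommGroup F']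
    [Module Ahat F'] (g : Twist θ F F') {i : E →ₗ[Ahat] F} (hi : Function.Injective i) :
    Function.Injective (f.mapLinear g i) :=
  g.toAddEquiv.injective.comp (hi.comp f.toAddEquiv.symm.injective)

end Twist

/-- The identity as an equivalence from `E` to `θ_*(E)`. -/
def ChangeVar.twist (θ : ChangeOfVariable) (E : Type*) [AddCommGroup E] [Module Ahat E] :
    Twist θ E (ChangeVar θ E) where
  toAddEquiv := ChangeVar.of θ E
  map_Theta_smul' _ _ := rfl

/-! ### Bases over ℂ[[b]] detected on E/bE -/

namespace ABModule

section Basis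

variable {E : Type*} [AddCommGroup E] [Module Ahat E] {ι : Type*} [Fintype ι]

/-- `e` is a basis of `E` over `ℂ[[b]]`, expressed through `E / bE`: multiplication by `b` is
injective, `E` is `b`-adically separated and `e` induces a basis of `E / bE`. -/
structure IsBasisB (e : ι → E) : Prop where
  inj : ∀ x : E, Ahat.b • x = 0 → x = 0
  sep : ∀ x : E, (∀ n : ℕ, ∃ y : E, x = Ahat.b ^ n • y) → x = 0
  span : ∀ x : E, ∃ (c : ι → ℂ) (y : E), x = ∑ i, Ahat.scalar (c i) • e i + Ahat.b • y
  indep : ∀ (c : ι → ℂ) (y : E), ∑ i, Ahat.scalar (c i) • e i = Ahat.b • y → c = 0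

theorem ofB_eq (S : PowerSeries ℂ) : Ahat.ofB S = Ahat.scalar (constantCoeff S) +
    Ahat.b * Ahat.ofB (mk fun p => PowerSeries.coeff (p + 1) S) := by
  rw [Ahat.scalar, RingHom.comp_apply, show Ahat.b = Ahat.ofB X from rfl, ← map_mul, ← map_add,
    add_comm, ← eq_X_mul_shift_add_const]

theorem sum_ofB_smul (e : ι → E) (S : ι → PowerSeries ℂ) : ∑ i, Ahat.ofB (S i) • e i =
    ∑ i, Ahat.scalar (constantCoeff (S i)) • e i +
      Ahat.b • ∑ i, Ahat.ofB (mk fun p => PowerSeries.coeff (p + 1) (S i)) • e i := by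
  rw [Finset.smul_sum, ← Finset.sum_add_distrib]
  refine Finset.sum_congr rfl fun i _ => ?_
  rw [← mul_smul, ← add_smul, ← ofB_eq]

/-- Independence modulo b kills the constant terms; cancelling b leaves the same relation for the
shifted series. Separation and generation play no role, so the lemma also yields injectivity of maps
defined on a basis. -/
theorem eq_zero_of_sum_ofB_smul {e : ι → E} (inj : ∀ x : E, Ahat.b • x = 0 → x = 0)
    (indep : ∀ (c : ι → ℂ) (y : E), ∑ i, Ahat.scalar (c i) • e i = Ahat.b • y → c = 0)
    {S : ι → PowerSeries ℂ} (h : ∑ i, Ahat.ofB (S i) • e i = 0) : S = 0 := by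
  have key : ∀ t, ∀ S : ι → PowerSeries ℂ, ∑ i, Ahat.ofB (S i) • e i = 0 →
      ∀ i, ∀ s < t, PowerSeries.coeff s (S i) = 0 := by
    intro t
    induction t with
    | zero => intro S _ i s hs; omega
    | succ t ih =>
      intro S h i s hs
      rw [sum_ofB_smul] at h
      have h0 := indep (fun i => constantCoeff (S i)) _
        ((eq_neg_of_add_eq_zero_left h).trans (smul_neg _ _).symm)
      have h0' : ∀ i, constantCoeff (S i) = 0 := fun i => congrFun h0 i
      simp only [h0', map_zero, zero_smul, Finset.sum_const_zero, zero_add] at h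
      rcases s with _ | s
      · rw [coeff_zero_eq_constantCoeff_apply, h0']
      · have := ih _ (inj _ h) i s (by omega)
        rwa [coeff_mk] at this
  exact funext fun i => PowerSeries.ext fun n => key (n + 1) S h i n (by omega)

/-- Iterating x = ∑ c_i e_i + b y produces the coefficients of the candidate series. The defect D
satisfies D x = b D(y), hence lies in every b^n E and vanishes by separation. Completeness need not
be assumed, since all of ℂ[[b]] already acts. -/
theorem IsBasisB.exists_eq_sum {e : ι → E} (h : IsBasisB e) (x : E) :
    ∃ S : ι → PowerSeries ℂ, x = ∑ i, Ahat.ofB (S i) • e i := by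
  choose c y hcy using h.span
  let S : E → ι → PowerSeries ℂ := fun x i => PowerSeries.mk fun n => c (y^[n] x) i
  let D : E → E := fun x => x - ∑ i, Ahat.ofB (S x i) • e i
  have hD : ∀ x, D x = Ahat.b • D (y x) := by
    intro x
    have h1 : ∀ i, constantCoeff (S x i) = c x i := fun i => by
      rw [← coeff_zero_eq_constantCoeff_apply, coeff_mk]; rfl
    have h2 : ∀ i, (PowerSeries.mk fun p => PowerSeries.coeff (p + 1) (S x i)) = S (y x) i :=
      fun i => by ext n; rw [coeff_mk, coeff_mk, coeff_mk]; rfl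
    simp only [D]
    rw [sum_ofB_smul]
    simp only [h1, h2]
    rw [smul_sub]
    conv_lhs => enter [1]; rw [hcy x]
    abel
  have hD' : ∀ n x, D x = Ahat.b ^ n • D (y^[n] x) := by
    intro n
    induction n with
    | zero => intro x; simp
    | succ n ih => intro x; rw [hD, ih, ← mul_smul, ← pow_succ']; rfl
  exact ⟨S x, sub_eq_zero.1 (h.sep (D x) fun n => ⟨_, hD' n x⟩)⟩

section

attribute [local instance] seriesModule

theorem IsBasisB.toBasis {e : ι → E} (h : IsBasisB e) :
    ∃ B : Module.Basis ι (PowerSeries ℂ) E, ∀ i, B i = e i := by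
  have hli : LinearIndependent (PowerSeries ℂ) e :=
    Fintype.linearIndependent_iff.2 fun S hS i =>
      congrFun (eq_zero_of_sum_ofB_smul h.inj h.indep hS) i
  refine ⟨Module.Basis.mk hli fun x _ => ?_, fun i => by simp⟩
  obtain ⟨S, rfl⟩ := h.exists_eq_sum x
  exact Submodule.sum_mem _ fun i _ => Submodule.smul_mem (Submodule.span (PowerSeries ℂ) _) (S i)
    (Submodule.subset_span ⟨i, rfl⟩)

theorem isBasisB_of_basis (B : Module.Basis ι (PowerSeries ℂ) E) : IsBasisB (fun i => B i) where
  inj x hx := by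
    refine B.ext_elem fun i => ?_
    have h := congrArg (fun z => B.repr z i) (show (X : PowerSeries ℂ) • x = 0 from hx)
    simp only [map_smul, Finsupp.smul_apply, smul_eq_mul, map_zero, Finsupp.zero_apply] at h
    rw [map_zero, Finsupp.zero_apply]
    exact (mul_eq_zero.1 h).resolve_left X_ne_zero
  sep x hx := by
    refine B.ext_elem fun i => PowerSeries.ext fun n => ?_
    obtain ⟨y, hy⟩ := hx (n + 1)
    have h1 : x = (X ^ (n + 1) : PowerSeries ℂ) • y := by
      rw [hy]
      change _ = Ahat.ofB (X ^ (n + 1)) • y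
      rw [map_pow]; rfl
    rw [h1, map_smul, Finsupp.smul_apply, smul_eq_mul, coeff_X_pow_mul', if_neg (by omega)]
    simp
  span x := by
    exact ⟨_, _, (B.sum_repr x).symm.trans (sum_ofB_smul (fun i => B i) fun i => B.repr x i)⟩
  indep c y h := by
    funext i
    have h2 : ∑ i, (C (c i) : PowerSeries ℂ) • B i = (X : PowerSeries ℂ) • y := h
    have h1 := congrArg (fun z => constantCoeff (B.repr z i)) h2
    simp only [B.repr_sum_self] at h1
    simpa using h1

theorem IsBasisB.isFree {e : ι → E} (h : IsBasisB e) : IsFree E := by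
  obtain ⟨B, -⟩ := h.toBasis
  exact Module.Free.of_basis B

theorem IsBasisB.isFinite {e : ι → E} (h : IsBasisB e) : IsFinite E := by
  obtain ⟨B, -⟩ := h.toBasis
  exact Module.Finite.of_basis B

theorem IsBasisB.rank_eq {e : ι → E} (h : IsBasisB e) : rank E = Fintype.card ι := by
  obtain ⟨B, -⟩ := h.toBasis
  exact Module.finrank_eq_card_basis B

theorem exists_isBasisB (hE : IsFree E) (hE' : IsFinite E) :
    ∃ (n : ℕ) (e : Fin n → E), IsBasisB e := by
  have h1 : Module.Free (PowerSeries ℂ) E := hE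
  have h2 : Module.Finite (PowerSeries ℂ) E := hE'
  exact ⟨_, _, isBasisB_of_basis (Module.finBasis (PowerSeries ℂ) E)⟩

/-- ℂ[[b]] is a principal ideal domain, so submodules of finite free modules are finite free. -/
theorem isFree_isFinite_of_injective {F : Type*} [AddCommGroup F] [Module Ahat F]
    (hF : IsFree F) (hF' : IsFinite F) (i : E →ₗ[Ahat] F) (hi : Function.Injective i) :
    IsFree E ∧ IsFinite E := by
  have h1 : Module.Free (PowerSeries ℂ) F := hF
  have h2 : Module.Finite (PowerSeries ℂ) F := hF'
  let j : E →ₗ[PowerSeries ℂ] F :=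
    { toFun := i
      map_add' := map_add i
      map_smul' := fun S x => i.map_smul (Ahat.ofB S) x }
  have h3 : Function.Injective j := hi
  have h4 : Module.Finite (PowerSeries ℂ) E := Module.Finite.of_injective j h3
  exact ⟨Module.Free.of_equiv (LinearEquiv.ofInjective j h3).symm, h4⟩

theorem isFinite_quotient (hE : IsFinite E) (F : Submodule Ahat E) : IsFinite (E ⧸ F) := by
  have h2 : Module.Finite (PowerSeries ℂ) E := hE
  let j : E →ₗ[PowerSeries ℂ] E ⧸ F :=
    { toFun := F.mkQ
      map_add' := map_add F.mkQ
      map_smul' := fun S x => F.mkQ.map_smul (Ahat.ofB S) x }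
  exact Module.Finite.of_surjective j F.mkQ_surjective

end

end Basis

end ABModule

/-! ### Transport of freeness, rank and normality -/

namespace Twist

open ABModule

variable {θ : ChangeOfVariable} {E E' : Type*} [AddCommGroup E] [Module Ahat E]
  [AddCommGroup E'] [Module Ahat E'] (f : Twist θ E E')
  {ι : Type*} [Fintype ι]

theorem ofA_inv_smul_smul {S : PowerSeries ℂ} (h : S * S⁻¹ = 1) (x : E) :
    Ahat.ofA S⁻¹ • Ahat.ofA S • x = x := by
  rw [← mul_smul, ← map_mul, mul_comm, h, map_one, one_smul]

/-- On the side of E the action of b on E' is that of β = b θ'(a), with θ'(a) invertible. Hence β is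
injective, βE = bE and β^n E ⊂ b^n E; scalars are fixed by Θ, so the same vectors remain a basis
modulo b. -/
theorem isBasisB {e : ι → E} (h : IsBasisB e) : IsBasisB (fun i => f.toAddEquiv (e i)) where
  inj x' hx := by
    obtain ⟨x, rfl⟩ := f.toAddEquiv.surjective x'
    rw [← map_beta_smul, map_eq_zero_iff _ f.toAddEquiv.injective, ChangeOfVariable.beta,
      mul_smul] at hx
    rw [← ofA_inv_smul_smul θ.derivative_mul_inv x, h.inj _ hx, smul_zero, map_zero]
  sep x' hx := by
    obtain ⟨x, rfl⟩ := f.toAddEquiv.surjective x'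
    rw [h.sep x, map_zero]
    intro n
    obtain ⟨y', hy⟩ := hx n
    obtain ⟨y, rfl⟩ := f.toAddEquiv.surjective y'
    rw [← map_beta_pow_smul] at hy
    obtain ⟨z, hz⟩ := θ.exists_beta_pow_eq n
    exact ⟨z • y, by rw [← mul_smul, ← hz, f.toAddEquiv.injective hy]⟩
  span x' := by
    obtain ⟨x, rfl⟩ := f.toAddEquiv.surjective x'
    obtain ⟨c, y, hx⟩ := h.span x
    have hx' := congrArg f.toAddEquiv hx
    rw [map_add, map_b_smul, map_sum] at hx'
    simp only [map_scalar_smul] at hx'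
    exact ⟨c, _, hx'⟩
  indep c y' hc := by
    obtain ⟨y, rfl⟩ := f.toAddEquiv.surjective y'
    simp only [← map_scalar_smul] at hc
    rw [← map_beta_smul, ← map_sum, ChangeOfVariable.beta, mul_smul] at hc
    exact h.indep c _ (f.toAddEquiv.injective hc)

theorem isFree_isFinite_rank (f : Twist θ E E') (hE : IsFree E) (hE' : IsFinite E) :
    IsFree E' ∧ IsFinite E' ∧ rank E' = rank E := by
  obtain ⟨n, e, he⟩ := exists_isBasisB hE hE'
  have h := f.isBasisB he
  exact ⟨h.isFree, h.isFinite, h.rank_eq.trans he.rank_eq.symm⟩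

theorem isNormal (hE : IsFinite E) {F : Submodule Ahat E} (hF : IsNormal F) :
    IsNormal (f.mapSubmodule F) :=
  ((f.quotient F).isFree_isFinite_rank hF (isFinite_quotient hE F)).1

end Twist

/-! ### Transport of simple poles, saturation and the Bernstein polynomial -/

namespace Twist

open ABModule

section

variable {θ : ChangeOfVariable} {E E' : Type*} [AddCommGroup E] [Module Ahat E]
  [AddCommGroup E'] [Module Ahat E'] (f : Twist θ E E')

theorem map_a_smul (x : E) : f.toAddEquiv (Ahat.a • x) =
    Ahat.a • f.toAddEquiv (Ahat.ofA θ.quot⁻¹ • x) := by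
  rw [← map_alpha_smul, ← mul_smul, ← θ.a_eq]

/-- The units relating a to α and b to β preserve every submodule, so stability under b⁻¹a passes
through the twist. The version relative to F serves the minimality clause of a saturation; F = ⊤
gives simple poles. -/
theorem exists_a_smul_eq_b_smul {F : Submodule Ahat E'}
    (hF : ∀ x ∈ F, ∃ y ∈ F, Ahat.a • x = Ahat.b • y) {x : E} (hx : f.toAddEquiv x ∈ F) :
    ∃ y, f.toAddEquiv y ∈ F ∧ Ahat.a • x = Ahat.b • y := by
  have h1 : f.toAddEquiv (Ahat.ofA θ.quot⁻¹ • x) ∈ F := by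
    rw [f.map_smul]; exact F.smul_mem _ hx
  obtain ⟨y', hy', h⟩ := hF _ h1
  obtain ⟨y, rfl⟩ := f.toAddEquiv.surjective y'
  refine ⟨Ahat.ofA (derivative ℂ θ.series) • y, ?_, ?_⟩
  · rw [f.map_smul]; exact F.smul_mem _ hy'
  · apply f.toAddEquiv.injective
    rw [map_a_smul, h, ← map_beta_smul, ChangeOfVariable.beta, mul_smul]

theorem isSimplePole (f : Twist θ E E') (hE : IsSimplePole E) : IsSimplePole E' := by
  obtain ⟨h1, h2, -⟩ := f.isFree_isFinite_rank hE.1 hE.2.1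
  refine ⟨h1, h2, fun x => ?_⟩
  obtain ⟨y, -, hy⟩ := f.symm.exists_a_smul_eq_b_smul (F := ⊤)
    (fun x _ => (hE.2.2 x).imp fun y hy => ⟨trivial, hy⟩) (x := x) trivial
  exact ⟨y, hy⟩

theorem map_span_singleton (e : E) (he : Submodule.span Ahat {e} = ⊤) :
    Submodule.span Ahat {f.toAddEquiv e} = ⊤ := by
  rw [eq_top_iff]
  intro y' _
  obtain ⟨y, rfl⟩ := f.toAddEquiv.surjective y'
  have hy : y ∈ Submodule.span Ahat {e} := he ▸ trivial
  obtain ⟨x, rfl⟩ := Submodule.mem_span_singleton.1 hy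
  rw [f.map_smul]
  exact Submodule.smul_mem _ _ (Submodule.mem_span_singleton_self _)

end

section

universe u

variable {θ : ChangeOfVariable} {E E' : Type u} [AddCommGroup E] [Module Ahat E]
  [AddCommGroup E'] [Module Ahat E']

theorem isRegular (f : Twist θ E E') (hE : IsRegular E) : IsRegular E' := by
  obtain ⟨F, _, _, i, hF, hi⟩ := hE
  have g := ChangeVar.twist θ F
  exact ⟨ChangeVar θ F, inferInstance, inferInstance, f.mapLinear g i, g.isSimplePole hF,
    f.mapLinear_injective g hi⟩

theorem isSaturation (f : Twist θ E E') {F F' : Type u} [AddCommGroup F] [Module Ahat F]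
    [AddCommGroup F'] [Module Ahat F'] (g : Twist θ F F') {i : E →ₗ[Ahat] F}
    (hi : IsSaturation i) : IsSaturation (f.mapLinear g i) := by
  refine ⟨g.isSimplePole hi.1, f.mapLinear_injective g hi.2.1, fun G hG h => ?_⟩
  have h1 : g.symm.mapSubmodule G = ⊤ := by
    refine hi.2.2 _ ?_ fun x hx => ?_
    · rintro _ ⟨x, rfl⟩
      exact hG ⟨f.toAddEquiv x, f.mapLinear_apply g i x⟩
    · exact g.exists_a_smul_eq_b_smul h hx
  rw [← g.mapSubmodule_symm_mapSubmodule G, h1]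
  rfl

attribute [local instance] complexModule

/-- A twist as a `ℂ`-linear equivalence. -/
def toLinearEquiv (f : Twist θ E E') : E ≃ₗ[ℂ] E' where
  toAddEquiv := f.toAddEquiv
  map_smul' := f.map_scalar_smul

theorem map_range_mulLeft_b (f : Twist θ E E') :
    (LinearMap.range (mulLeft E Ahat.b)).map (f.toLinearEquiv : E →ₗ[ℂ] E') =
      LinearMap.range (mulLeft E' Ahat.b) := by
  ext x'
  constructor
  · rintro ⟨_, ⟨y, rfl⟩, rfl⟩
    exact ⟨_, (f.map_b_smul y).symm⟩
  · rintro ⟨y', rfl⟩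
    obtain ⟨y, rfl⟩ := f.toAddEquiv.surjective y'
    exact ⟨θ.beta • y, ⟨Ahat.ofA (derivative ℂ θ.series) • y, (mul_smul _ _ _).symm⟩,
      f.map_beta_smul y⟩

/-- Because aF ⊂ bF, a acts as zero on F/bF and only the constant term of S(a) survives. -/
theorem mk_ofA_smul {F : Type*} [AddCommGroup F] [Module Ahat F]
    (hF : ∀ x : F, ∃ y : F, Ahat.a • x = Ahat.b • y) (S : PowerSeries ℂ) (x : F) :
    (Submodule.Quotient.mk (Ahat.ofA S • x) : F ⧸ LinearMap.range (mulLeft F Ahat.b)) =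
      constantCoeff S • Submodule.Quotient.mk x := by
  rw [← Submodule.Quotient.mk_smul, Submodule.Quotient.eq]
  obtain ⟨y, hy⟩ := hF (Ahat.ofA (PowerSeries.mk fun p => PowerSeries.coeff (p + 1) S) • x)
  refine ⟨y, hy.symm.trans ?_⟩
  conv_rhs => enter [1]; rw [eq_X_mul_shift_add_const S]
  rw [map_add, map_mul, add_smul, mul_smul, ← Ahat.scalar_eq]
  exact (add_sub_cancel_right _ _).symm

/-- The saturation of E' is the twist of that of E, and the two quotients by b are identified
ℂ-linearly. This identification conjugates the two operators b⁻¹a, so their minimal polynomials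
agree. -/
theorem isBernsteinPolynomial (f : Twist θ E E') {B : Polynomial ℂ}
    (hB : IsBernsteinPolynomial E B) : IsBernsteinPolynomial E' B := by
  obtain ⟨F, _, _, i, T, hi, hT, rfl⟩ := hB
  have g := ChangeVar.twist θ F
  let q : (F ⧸ LinearMap.range (mulLeft F Ahat.b)) ≃ₗ[ℂ]
      (ChangeVar θ F ⧸ LinearMap.range (mulLeft (ChangeVar θ F) Ahat.b)) :=
    Submodule.Quotient.equiv _ _ g.toLinearEquiv g.map_range_mulLeft_b
  refine ⟨ChangeVar θ F, inferInstance, inferInstance, f.mapLinear g i, q.conjAlgEquiv ℂ T,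
    f.isSaturation g hi, fun x' y' h => ?_, ?_⟩
  · obtain ⟨x, rfl⟩ := g.toAddEquiv.surjective x'
    obtain ⟨y, rfl⟩ := g.toAddEquiv.surjective y'
    rw [← map_alpha_smul, ← map_beta_smul] at h
    have h1 := g.toAddEquiv.injective h
    rw [θ.alpha_eq, ChangeOfVariable.beta, mul_smul, mul_smul] at h1
    -- The relation α x = β y reads a (θ(a)/a) x = b θ'(a) y. Modulo b both units act as the nonzero
    -- scalar θ'(0), which then cancels.
    have h2 := hT _ _ h1
    rw [mk_ofA_smul hi.1.2.2, mk_ofA_smul hi.1.2.2, _root_.map_smul, θ.constantCoeff_quot,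
      θ.constantCoeff_derivative] at h2
    have h3 := smul_right_injective _ θ.deriv_ne_zero h2
    have h4 : ∀ z, (Submodule.Quotient.mk (g.toAddEquiv z) :
      ChangeVar θ F ⧸ LinearMap.range (mulLeft (ChangeVar θ F) Ahat.b)) =
        q (Submodule.Quotient.mk z) := fun _ => rfl
    rw [h4, h4, LinearEquiv.conjAlgEquiv_apply_apply, LinearEquiv.symm_apply_apply, h3]
  · rw [← map_neg, minpoly.algEquiv_eq]

theorem isPrimitiveFresco (f : Twist θ E E') {lam : ℚ} (hE : IsPrimitiveFresco E lam) :
    IsPrimitiveFresco E' lam := by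
  obtain ⟨⟨⟨h1, B, h2, h3⟩, e, h4⟩, B', h5, h6⟩ := hE
  exact ⟨⟨⟨f.isRegular h1, B, f.isBernsteinPolynomial h2, h3⟩, _, f.map_span_singleton e h4⟩,
    B', f.isBernsteinPolynomial h5, h6⟩

end

end Twist

namespace ABModule

theorem IsRegular.isFree_isFinite {E : Type*} [AddCommGroup E] [Module Ahat E]
    (hE : IsRegular E) : IsFree E ∧ IsFinite E := by
  obtain ⟨F, _, _, i, hF, hi⟩ := hE
  exact isFree_isFinite_of_injective hF.1 hF.2.1 i hi

end ABModule

/-! ### Powers and logarithm of θ(a)/a -/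

/-- The solution is exp of the primitive of q vanishing at 0. -/
theorem PowerSeries.exists_derivative_eq_mul (q : PowerSeries ℂ) :
    ∃ g : PowerSeries ℂ, derivative ℂ g = q * g ∧ constantCoeff g = 1 := by
  have hs : HasSubst (Ahat.prim q) := HasSubst.of_constantCoeff_zero' (Ahat.constantCoeff_prim q)
  refine ⟨(exp ℂ).subst (Ahat.prim q), ?_, ?_⟩
  · rw [derivative_subst hs, derivative_exp, Ahat.derivative_prim, mul_comm]
  -- Writing exp as X·(…) + 1 isolates the constant term, since the substituted series has none.
  · rw [eq_X_mul_shift_add_const (exp ℂ), subst_add hs, subst_mul hs, subst_X hs,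
      constantCoeff_exp, map_one, ← coe_substAlgHom hs, map_one, map_add, map_mul]
    erw [Ahat.constantCoeff_prim]
    simp

namespace ChangeOfVariable

variable (θ : ChangeOfVariable)

theorem derivative_series :
    derivative ℂ θ.series = θ.quot + X * derivative ℂ θ.quot := by
  rw [series_eq, Derivation.leibniz, derivative_X]
  simp only [smul_eq_mul]
  ring

/-- The power `(θ(a) / a) ^ (μ - 1)`, up to a scalar factor. -/
theorem exists_power (μ : ℂ) : ∃ g : PowerSeries ℂ, constantCoeff g = 1 ∧
    θ.quot * derivative ℂ g = C (μ - 1) * derivative ℂ θ.quot * g := by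
  obtain ⟨g, hg, hg0⟩ := exists_derivative_eq_mul (C (μ - 1) * derivative ℂ θ.quot * θ.quot⁻¹)
  refine ⟨g, hg0, ?_⟩
  rw [hg]
  linear_combination (C (μ - 1) * derivative ℂ θ.quot * g) * θ.quot_mul_inv

/-- The logarithm of `θ(a) / a`, up to an additive constant. -/
theorem exists_log : ∃ L : PowerSeries ℂ, constantCoeff L = 0 ∧
    θ.quot * derivative ℂ L = derivative ℂ θ.quot := by
  refine ⟨Ahat.prim (derivative ℂ θ.quot * θ.quot⁻¹), Ahat.constantCoeff_prim _, ?_⟩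
  rw [Ahat.derivative_prim]
  linear_combination (derivative ℂ θ.quot) * θ.quot_mul_inv

end ChangeOfVariable

namespace Ahat

theorem a_mul_ofA (S : PowerSeries ℂ) : a * ofA S = ofA S * a := by
  rw [show a = ofA X from rfl, ← map_mul, ← map_mul, mul_comm]

/-- If `a x = μ b x + b y` then `a` acts on `S(a) x` as on `S(s) s^{μ - 1}`, up to `y`. -/
theorem a_smul_ofA_smul {E : Type*} [AddCommGroup E] [Module Ahat E] {μ : ℂ} {x y : E}
    (h : a • x = b • (scalar μ • x + y)) (S : PowerSeries ℂ) :
    a • ofA S • x = b • (ofA (C μ * S + X * derivative ℂ S) • x + ofA S • y) := by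
  have h1 : ofA S * b = b * ofA S + b * ofA (derivative ℂ S) * b := by
    rw [b_mul_ofA]; abel
  rw [← mul_smul, a_mul_ofA, mul_smul, h, ← mul_smul (ofA S) b, h1]
  rw [add_smul, mul_smul (b * _) b, ← h, ← mul_smul _ a, mul_assoc b, ← a_mul_ofA, mul_smul b,
    mul_smul b, ← smul_add, smul_add, map_add, map_mul, map_mul, ← scalar_eq, add_smul,
    smul_add (ofA S), scalar_comm, mul_smul (ofA S), show ofA X = a from rfl, ← smul_add]
  congr 1
  abel

end Ahat

/-! ### Kernels of a - μb and the invariant δ -/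

namespace Twist

open ABModule

universe u

variable {θ : ChangeOfVariable} {E E' : Type*} [AddCommGroup E] [Module Ahat E]
  [AddCommGroup E'] [Module Ahat E']

section

attribute [local instance] complexModule

theorem mem_ker_mulLeft {F : Type*} [AddCommGroup F] [Module Ahat F] {μ : ℂ} {x : F} :
    x ∈ LinearMap.ker (mulLeft F (Ahat.a - Ahat.scalar μ * Ahat.b)) ↔
      Ahat.a • x = Ahat.b • (Ahat.scalar μ • x) := by
  rw [← mul_smul, ← Ahat.scalar_comm, ← sub_eq_zero, ← sub_smul]
  exact Iff.rfl

/-- If x behaves like s^{μ-1}, then g(a) x with g = (θ(s)/s)^{μ-1} behaves like θ(s)^{μ-1} and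
satisfies α g(a) x = μ β g(a) x. The map x ↦ f(g(a) x) is injective because g is a unit. -/
theorem exists_ker_injective (f : Twist θ E E') (μ : ℂ) :
    ∃ j : LinearMap.ker (mulLeft E (Ahat.a - Ahat.scalar μ * Ahat.b)) →ₗ[ℂ]
      LinearMap.ker (mulLeft E' (Ahat.a - Ahat.scalar μ * Ahat.b)), Function.Injective j := by
  obtain ⟨g, hg0, hg⟩ := θ.exists_power μ
  have hg' : g * g⁻¹ = 1 := PowerSeries.mul_inv_cancel _ (by rw [hg0]; exact one_ne_zero)
  let j0 : E →ₗ[ℂ] E' :=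
    { toFun := fun x => f.toAddEquiv (Ahat.ofA g • x)
      map_add' := fun x y => by rw [smul_add, map_add]
      map_smul' := fun c x => by
        change f.toAddEquiv (Ahat.ofA g • Ahat.scalar c • x) = Ahat.scalar c • _
        rw [← map_scalar_smul, ← mul_smul, ← mul_smul, Ahat.scalar_comm] }
  have hj0 : Function.Injective j0 := by
    intro x y hxy
    have h1 := congrArg (fun z => Ahat.ofA g⁻¹ • z) (f.toAddEquiv.injective hxy)
    simpa only [ofA_inv_smul_smul hg'] using h1
  refine ⟨j0.restrict fun x hx => ?_, fun x y hxy => Subtype.ext (hj0 (congrArg Subtype.val hxy))⟩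
  rw [mem_ker_mulLeft] at hx ⊢
  -- The series is (θ(a)/a) g(a) because α = a · (θ(a)/a); the differential equation for g then
  -- turns μS + XS' into μ θ' g.
  have h := Ahat.a_smul_ofA_smul (y := (0 : E)) (hx.trans (by rw [add_zero])) (θ.quot * g)
  change Ahat.a • f.toAddEquiv (Ahat.ofA g • x) =
    Ahat.b • Ahat.scalar μ • f.toAddEquiv (Ahat.ofA g • x)
  rw [← map_alpha_smul, ← map_scalar_smul, ← map_beta_smul, θ.alpha_eq, ChangeOfVariable.beta]
  congr 1
  rw [mul_smul, ← mul_smul (Ahat.ofA θ.quot), ← map_mul, h, smul_zero, add_zero, mul_smul,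
    Ahat.scalar_eq, ← mul_smul (Ahat.ofA _), ← mul_smul (Ahat.ofA _ * _), ← map_mul,
    ← map_mul, θ.derivative_series]
  congr 3
  rw [Derivation.leibniz, smul_eq_mul, smul_eq_mul, hg, map_sub, map_one]
  ring

theorem kerDim_eq {E E' : Type u} [AddCommGroup E] [Module Ahat E] [AddCommGroup E']
    [Module Ahat E'] (f : Twist θ E E') (μ : ℂ) : kerDim E' μ = kerDim E μ := by
  obtain ⟨i, hi⟩ := f.exists_ker_injective μ
  obtain ⟨j, hj⟩ := f.symm.exists_ker_injective μ
  -- The two injections are compared as cardinal ranks, so finite dimensionality of the kernels is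
  -- not needed.
  exact congrArg Cardinal.toNat
    (le_antisymm (LinearMap.rank_le_of_injective j hj) (LinearMap.rank_le_of_injective i hi))

theorem delta_eq {E E' : Type u} [AddCommGroup E] [Module Ahat E] [AddCommGroup E']
    [Module Ahat E'] (f : Twist θ E E') (lam : ℚ) : delta E' lam = delta E lam := by
  simp only [delta, f.kerDim_eq]

end

end Twist

/-! ### Linearity over Â tested on a, b and scalars -/

namespace Ahat

theorem a_mul_b : a * b = b * a + b * b := by
  rw [← pow_two, ← a_mul_b_sub]; abel

/-- With S = c + bT, the defect for S is b times the defect for T. It is thus divisible on the left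
by every power of b, and its coefficients vanish by the recursion for b x. -/
theorem a_mul_ofB (S : PowerSeries ℂ) :
    a * ofB S = ofB S * a + ofB (X ^ 2 * derivative ℂ S) := by
  let R : PowerSeries ℂ → Ahat := fun S =>
    a * ofB S - (ofB S * a + ofB (X ^ 2 * derivative ℂ S))
  have hR : ∀ S, R S = b * R (PowerSeries.mk fun p => PowerSeries.coeff (p + 1) S) := by
    intro S
    set T := PowerSeries.mk fun p => PowerSeries.coeff (p + 1) S with hT
    have h1 : ofB S = scalar (constantCoeff S) + b * ofB T := ABModule.ofB_eq S
    have h2 : X ^ 2 * derivative ℂ S = X * (X * T) + X * (X ^ 2 * derivative ℂ T) := by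
      conv_lhs => rw [eq_X_mul_shift_add_const S]
      rw [map_add, Derivation.leibniz, derivative_X, derivative_C, smul_eq_mul, smul_eq_mul]
      ring
    simp only [R]
    rw [h2, h1, map_add, map_mul, map_mul, map_mul, show ofB X = b from rfl, mul_add, add_mul,
      scalar_comm, ← mul_assoc a b, a_mul_b]
    noncomm_ring
  have key : ∀ K, ∀ S, ∀ i < K, (R S).coeff i = 0 := by
    intro K
    induction K with
    | zero => intro S i hi; omega
    | succ K ih =>
      intro S i hi
      rw [hR]
      have h1 : ∀ i ≤ K, (b * R (PowerSeries.mk fun p => PowerSeries.coeff (p + 1) S)).coeff i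
          = 0 := by
        intro i
        induction i with
        | zero => intro _; exact coeff_b_mul_zero _
        | succ i ihi =>
          intro hi
          rw [coeff_b_mul_succ, ihi (by omega), ih _ _ (by omega), map_zero, sub_zero]
      exact h1 i (by omega)
  exact sub_eq_zero.1 (ext fun n => key (n + 1) S n (by omega))

/-- An additive map into a `b`-adically separated module that commutes with `a`, `b` and the
scalars is `Â`-linear. -/
theorem map_smul_of_comm {V F : Type*} [AddCommGroup V] [Module Ahat V] [AddCommGroup F]
    [Module Ahat F] (f : V →+ F) (hV : ∀ v : V, ∃ w : V, a • v = b • w)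
    (hF : ∀ x : F, (∀ n : ℕ, ∃ y : F, x = b ^ n • y) → x = 0)
    (ha : ∀ v, f (a • v) = a • f v) (hb : ∀ v, f (b • v) = b • f v)
    (hs : ∀ c v, f (scalar c • v) = scalar c • f v) (x : Ahat) (v : V) :
    f (x • v) = x • f v := by
  have key : ∀ (n : ℕ) (x : Ahat) (v : V), ∃ y : F, f (x • v) - x • f v = b ^ n • y := by
    intro n
    induction n with
    | zero => intro x v; exact ⟨_, by rw [pow_zero, one_smul]⟩
    | succ n ih =>
      -- A factor b is moved to the left of z and gains one order of divisibility. Writing x = c + y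
      -- a + z b and a v = b w, every nonscalar term of x v contains such a factor.
      have h1 : ∀ (z : Ahat) (v : V), ∃ y : F, f (z • b • v) - z • b • f v = b ^ (n + 1) • y := by
        intro z v
        obtain ⟨z', hz⟩ := exists_mul_b_eq z
        obtain ⟨y, hy⟩ := ih z' v
        refine ⟨y, ?_⟩
        rw [← mul_smul, ← mul_smul, hz, mul_smul, mul_smul, hb, ← smul_sub, hy, ← mul_smul,
          ← pow_succ']
      intro x v
      obtain ⟨c, y, z, rfl⟩ := exists_eq_scalar_add x
      obtain ⟨w, hw⟩ := hV v
      obtain ⟨t, ht⟩ := h1 y w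
      obtain ⟨t', ht'⟩ := h1 z v
      refine ⟨t + t', ?_⟩
      rw [smul_add, ← ht, ← ht', ← hb w, ← hw, ha]
      simp only [add_smul, map_add, mul_smul, hs]
      abel
  exact sub_eq_zero.1 (hF _ fun n => key n x v)

end Ahat

/-! ### The pull-back of Ξ_λ by θ -/

namespace Xi

variable (lam : ℚ) (N : ℕ)

section

attribute [local instance] ABModule.seriesModule

/-- The identification of `Ξ_λ^{(N)}` with `ℂ[[b]]^{N+1}`. -/
def equivFun : Xi lam N ≃ₗ[PowerSeries ℂ] (Fin (N + 1) → PowerSeries ℂ) where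
  toFun v := v
  invFun v := v
  left_inv _ := rfl
  right_inv _ := rfl
  map_add' _ _ := rfl
  map_smul' S v := ofB_smul lam N S v

theorem isBasisB : ABModule.IsBasisB (e lam N) := by
  have h := ABModule.isBasisB_of_basis (Module.Basis.ofEquivFun (equivFun lam N))
  have h1 : (fun i => Module.Basis.ofEquivFun (equivFun lam N) i) = e lam N := by
    funext i
    rw [Module.Basis.coe_ofEquivFun]
    rfl
  rwa [h1] at h

end

variable {lam N}

theorem exists_a_smul_eq (v : Xi lam N) : ∃ w : Xi lam N, Ahat.a • v = Ahat.b • w := by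
  refine ⟨(fun j => X * derivative ℂ (v j) + (lam : ℂ) • v j + next N j v : Xi lam N),
    funext fun j => (congrFun (a_smul lam N v) j).trans
      (Eq.trans ?_ (b_smul_apply lam N _ j).symm)⟩
  change X ^ 2 * derivative ℂ (v j) + (lam : ℂ) • (X * v j) + X * next N j v = _
  rw [mul_add, mul_add, mul_smul_comm]
  ring

theorem next_aOp (v : Fin (N + 1) → PowerSeries ℂ) (j : Fin (N + 1)) :
    next N j (aOp lam N v) = aOp lam N (fun i => next N i v) j := by
  change _ = X ^ 2 * derivative ℂ (next N j v) + (lam : ℂ) • (X * next N j v) +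
    X * next N j fun i => next N i v
  by_cases h : (j : ℕ) + 1 < N + 1
  · simp only [next, dif_pos h]
    rfl
  · simp only [next, dif_neg h]
    simp

theorem next_mul (S : PowerSeries ℂ) (v : Fin (N + 1) → PowerSeries ℂ) (j : Fin (N + 1)) :
    next N j (fun i => S * v i) = S * next N j v := by
  by_cases h : (j : ℕ) + 1 < N + 1
  · simp only [next, dif_pos h]
    rfl
  · simp only [next, dif_neg h]
    simp

variable (lam N)

/-- The nilpotent endomorphism `e_j ↦ e_{j-1}` of the additive group `Ξ_λ^{(N)}`. -/
def shiftHom : Xi lam N →+ Xi lam N where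
  toFun v := fun j => next N j v
  map_zero' := funext fun j => map_zero (next N j)
  map_add' v w := funext fun j => map_add (next N j) v w

theorem shiftHom_ofB_smul (S : PowerSeries ℂ) (v : Xi lam N) :
    shiftHom lam N (Ahat.ofB S • v) = Ahat.ofB S • shiftHom lam N v := by
  rw [ofB_smul, ofB_smul]
  exact funext fun j => next_mul S v j

theorem shiftHom_a_smul (v : Xi lam N) :
    shiftHom lam N (Ahat.a • v) = Ahat.a • shiftHom lam N v := by
  rw [a_smul, a_smul]
  exact funext fun j => next_aOp v j

/-- The endomorphism `e_j ↦ e_{j-1}` is `Â`-linear. -/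
def shift : Xi lam N →ₗ[Ahat] Xi lam N where
  __ := shiftHom lam N
  map_smul' := Ahat.map_smul_of_comm (shiftHom lam N) exists_a_smul_eq (isBasisB lam N).sep
    (shiftHom_a_smul lam N) (shiftHom_ofB_smul lam N X) fun c => shiftHom_ofB_smul lam N (C c)

variable {lam N}

theorem shift_apply (v : Xi lam N) (j : Fin (N + 1)) : shift lam N v j = next N j v := rfl

theorem shift_pow_apply (k : ℕ) (v : Xi lam N) (j : Fin (N + 1)) (h : N + 1 ≤ j + k) :
    (shift lam N ^ k) v j = 0 := by
  induction k generalizing j with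
  | zero => omega
  | succ k ih =>
    rw [pow_succ', Module.End.mul_apply, shift_apply]
    unfold next
    split_ifs with h1
    · exact ih ⟨j + 1, h1⟩ (by simp only; omega)
    · rfl

theorem shift_pow_eq_zero (v : Xi lam N) : (shift lam N ^ (N + 1)) v = 0 :=
  funext fun j => shift_pow_apply _ v j (by omega)

theorem shift_e_zero : shift lam N (e lam N 0) = 0 := by
  funext j
  rw [shift_apply]
  unfold next
  split_ifs with h
  · change (Pi.single 0 1 : Fin (N + 1) → PowerSeries ℂ) ⟨(j : ℕ) + 1, h⟩ = 0
    refine Pi.single_eq_of_ne (M := fun _ : Fin (N + 1) => PowerSeries ℂ) (fun h0 => ?_) _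
    exact Nat.succ_ne_zero _ (congrArg Fin.val h0)
  · rfl

theorem shift_e_succ (j : Fin N) : shift lam N (e lam N j.succ) = e lam N j.castSucc := by
  funext i
  rw [shift_apply]
  change next N i (Pi.single j.succ 1) = (Pi.single j.castSucc 1 : Fin (N + 1) → PowerSeries ℂ) i
  unfold next
  split_ifs with h
  · simp [Pi.single_apply, Fin.ext_iff]
  · have : i ≠ j.castSucc := by
      rintro rfl
      simp at h
    simp [this]

/-- The two defining relations become one through the shift, which kills e_0. This is the form a v =
b(λv + shift v) that the operator exp(L shift) can handle. -/
theorem a_smul_e (j : Fin (N + 1)) : Ahat.a • e lam N j =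
    Ahat.b • (Ahat.scalar lam • e lam N j + shift lam N (e lam N j)) := by
  rw [smul_add, ← mul_smul, ← Ahat.scalar_comm, mul_smul]
  induction j using Fin.cases with
  | zero => rw [shift_e_zero, smul_zero, add_zero, a_smul_e_zero]
  | succ j => rw [shift_e_succ, a_smul_e_succ]

variable (lam N) in
/-- The coordinate of index `i` in `Ξ_λ^{(N)} / b Ξ_λ^{(N)}`. -/
def ev (i : Fin (N + 1)) : Xi lam N →+ ℂ :=
  (constantCoeff (R := ℂ)).toAddMonoidHom.comp
    (Pi.evalAddMonoidHom (fun _ : Fin (N + 1) => PowerSeries ℂ) i)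

theorem ev_b_smul (i : Fin (N + 1)) (v : Xi lam N) : ev lam N i (Ahat.b • v) = 0 := by
  change constantCoeff ((Ahat.b • v : Xi lam N) i) = 0
  rw [b_smul_apply]
  simp

theorem ev_scalar_smul (i : Fin (N + 1)) (c : ℂ) (v : Xi lam N) :
    ev lam N i (Ahat.scalar c • v) = c * ev lam N i v := by
  change constantCoeff ((Ahat.ofB (C c) • v : Xi lam N) i) = c * constantCoeff (v i)
  rw [ofB_smul]
  simp

theorem ev_ofA_smul (i : Fin (N + 1)) (S : PowerSeries ℂ) (v : Xi lam N) :
    ev lam N i (Ahat.ofA S • v) = constantCoeff S * ev lam N i v := by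
  obtain ⟨w, hw⟩ := exists_a_smul_eq (Ahat.ofA (mk fun p => PowerSeries.coeff (p + 1) S) • v)
  rw [Ahat.ofA_eq, ← Ahat.a_mul_ofA, add_smul, mul_smul, hw, map_add, ev_b_smul, add_zero,
    ev_scalar_smul]

theorem ev_e (i j : Fin (N + 1)) : ev lam N i (e lam N j) = if i = j then 1 else 0 := by
  change constantCoeff ((Pi.single j 1 : Fin (N + 1) → PowerSeries ℂ) i) = _
  rw [Pi.single_apply]
  split_ifs <;> simp

section

variable (g L : PowerSeries ℂ)

/-- The divided powers of a series. -/
def divPow (L : PowerSeries ℂ) (n : ℕ) : PowerSeries ℂ := C ((n.factorial : ℂ)⁻¹) * L ^ n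

theorem derivative_divPow_succ (n : ℕ) :
    derivative ℂ (divPow L (n + 1)) = divPow L n * derivative ℂ L := by
  have h : ((n.factorial : ℂ)⁻¹) = (((n + 1).factorial : ℂ)⁻¹) * ((n + 1 : ℕ) : ℂ) := by
    rw [Nat.factorial_succ]
    have := n.factorial_ne_zero
    push_cast
    field_simp
  rw [divPow, divPow, h, Derivation.leibniz, derivative_C, Derivation.leibniz_pow, map_mul,
    map_natCast]
  simp only [smul_eq_mul, nsmul_eq_mul, Nat.add_sub_cancel]
  ring

/-- The operator `g(a) exp (L(a) shift)`. -/
def twistOp : Xi lam N →+ Xi lam N :=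
  ∑ i ∈ Finset.range (N + 1), (DistribSMul.toAddMonoidHom (Xi lam N)
    (Ahat.ofA (g * divPow L i))).comp (shift lam N ^ i).toAddMonoidHom

theorem twistOp_apply (v : Xi lam N) : twistOp g L v =
    ∑ i ∈ Finset.range (N + 1), Ahat.ofA (g * divPow L i) • (shift lam N ^ i) v := by
  rw [twistOp, AddMonoidHom.finsetSum_apply]
  rfl

variable {g L}

theorem shift_twistOp (v : Xi lam N) :
    shift lam N (twistOp g L v) = twistOp g L (shift lam N v) := by
  simp only [twistOp_apply, map_sum, LinearMap.map_smul]
  refine Finset.sum_congr rfl fun i _ => ?_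
  rw [← Module.End.mul_apply, ← Module.End.mul_apply, ← pow_succ, ← pow_succ']

/-- Modulo b only the constant terms of the series in a act, and these leave just the identity term.
Triviality modulo b is the source of the injectivity of the pull-back. -/
theorem ev_twistOp (hg : constantCoeff g = 1) (hL : constantCoeff L = 0) (i : Fin (N + 1))
    (v : Xi lam N) : ev lam N i (twistOp g L v) = ev lam N i v := by
  rw [twistOp_apply, map_sum, Finset.sum_range_succ', Finset.sum_eq_zero, zero_add]
  · rw [ev_ofA_smul]
    simp [hg, divPow]
  · intro k _
    rw [ev_ofA_smul]
    simp [divPow, hL]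

/-- With g = (θ(s)/s)^{λ-1} and L = log(θ(s)/s), up to constants, the operator g exp(L shift) turns
s^{λ-1}(log s)^j/j! into its substitution by θ(s). The relation between a, b and the shift must then
hold with α and β in place of a and b. -/
theorem alpha_smul_twistOp (θ : ChangeOfVariable)
    (hg : θ.quot * derivative ℂ g = C ((lam : ℂ) - 1) * derivative ℂ θ.quot * g)
    (hL : θ.quot * derivative ℂ L = derivative ℂ θ.quot) {v : Xi lam N}
    (hv : Ahat.a • v = Ahat.b • (Ahat.scalar lam • v + shift lam N v)) :
    θ.alpha • twistOp g L v =
      θ.beta • (Ahat.scalar lam • twistOp g L v + shift lam N (twistOp g L v)) := by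
  have hv' : ∀ i : ℕ, Ahat.a • (shift lam N ^ i) v =
      Ahat.b • (Ahat.scalar lam • (shift lam N ^ i) v + (shift lam N ^ (i + 1)) v) := by
    intro i
    have := congrArg (shift lam N ^ i) hv
    rwa [LinearMap.map_smul, LinearMap.map_smul, map_add, LinearMap.map_smul,
      ← Module.End.mul_apply (shift lam N ^ i), ← pow_succ] at this
  let Q : PowerSeries ℂ := X * derivative ℂ θ.quot * g
  have e1 : ∀ i, θ.alpha • Ahat.ofA (g * divPow L i) • (shift lam N ^ i) v =
      Ahat.b • (Ahat.ofA (C (lam : ℂ) * (θ.quot * (g * divPow L i)) +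
          X * derivative ℂ (θ.quot * (g * divPow L i))) • (shift lam N ^ i) v +
        Ahat.ofA (θ.quot * (g * divPow L i)) • (shift lam N ^ (i + 1)) v) := by
    intro i
    rw [θ.alpha_eq, mul_smul, ← mul_smul (Ahat.ofA θ.quot), ← map_mul,
      Ahat.a_smul_ofA_smul (hv' i)]
  have e2 : ∀ i, X * derivative ℂ (θ.quot * (g * divPow L i)) =
      C (lam : ℂ) * X * derivative ℂ θ.quot * (g * divPow L i) +
        X * θ.quot * g * derivative ℂ (divPow L i) := by
    intro i
    rw [Derivation.leibniz, Derivation.leibniz]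
    simp only [smul_eq_mul]
    rw [map_sub, map_one] at hg
    linear_combination (X * divPow L i) * hg
  -- Differentiating a divided power of L lowers its index by one. The reindexing loses nothing: the
  -- term i = 0 has zero derivative, and the shift to the power N + 1 is zero.
  have e3 : ∑ i ∈ Finset.range (N + 1),
        Ahat.ofA (X * θ.quot * g * derivative ℂ (divPow L i)) • (shift lam N ^ i) v =
      ∑ i ∈ Finset.range (N + 1), Ahat.ofA (Q * divPow L i) • (shift lam N ^ (i + 1)) v := by
    rw [Finset.sum_range_succ', Finset.sum_range_succ, shift_pow_eq_zero, smul_zero, add_zero]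
    have h0 : derivative ℂ (divPow L 0) = 0 := by simp [divPow]
    rw [h0, mul_zero, map_zero, zero_smul, add_zero]
    refine Finset.sum_congr rfl fun i _ => ?_
    rw [derivative_divPow_succ]
    congr 2
    linear_combination (X * g * divPow L i) * hL
  have e4 : shift lam N (twistOp g L v) =
      ∑ i ∈ Finset.range (N + 1), Ahat.ofA (g * divPow L i) • (shift lam N ^ (i + 1)) v := by
    rw [twistOp_apply, map_sum]
    refine Finset.sum_congr rfl fun i _ => ?_
    rw [LinearMap.map_smul, ← Module.End.mul_apply, ← pow_succ']
  rw [e4, twistOp_apply, Finset.smul_sum, Finset.smul_sum, Finset.sum_congr rfl fun i _ => e1 i,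
    ← Finset.smul_sum, ChangeOfVariable.beta, mul_smul]
  congr 1
  simp only [e2, ← add_assoc, map_add (Ahat.ofA), add_smul]
  rw [smul_add, Finset.smul_sum, Finset.smul_sum, Finset.sum_add_distrib, Finset.sum_add_distrib,
    e3, add_assoc, ← Finset.sum_add_distrib, ← Finset.sum_add_distrib, ← Finset.sum_add_distrib]
  refine Finset.sum_congr rfl fun i _ => congrArg₂ (· + ·) ?_ ?_
  · rw [Ahat.scalar_eq, ← add_smul, ← mul_smul (Ahat.ofA (C _)), ← mul_smul, ← map_add,
      ← map_mul, ← map_mul, θ.derivative_series]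
    congr 2
    ring
  · rw [← add_smul, ← mul_smul, ← map_add, ← map_mul, θ.derivative_series]
    congr 2
    ring

end

variable (lam N) in
/-- The pull-back of multivalued functions by `θ`: an embedding of `Ξ_λ^{(N)}` in
`θ_*(Ξ_λ^{(N)})`. -/
theorem exists_pullback (θ : ChangeOfVariable) :
    ∃ φ : Xi lam N →ₗ[Ahat] ChangeVar θ (Xi lam N), Function.Injective φ := by
  obtain ⟨g, hg0, hg⟩ := θ.exists_power lam
  obtain ⟨L, hL0, hL⟩ := θ.exists_log
  let t := ChangeVar.twist θ (Xi lam N)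
  have ht := t.isBasisB (isBasisB lam N)
  let u : Xi lam N →+ ChangeVar θ (Xi lam N) := t.toAddEquiv.toAddMonoidHom.comp (twistOp g L)
  have hu : ∀ j, Ahat.a • u (e lam N j) =
      Ahat.b • (Ahat.scalar lam • u (e lam N j) + u (shift lam N (e lam N j))) := by
    intro j
    change Ahat.a • t.toAddEquiv (twistOp g L _) = Ahat.b • (Ahat.scalar lam •
      t.toAddEquiv (twistOp g L _) + t.toAddEquiv (twistOp g L _))
    rw [← t.map_alpha_smul, alpha_smul_twistOp θ hg hL (a_smul_e j), t.map_beta_smul, map_add,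
      t.map_scalar_smul, shift_twistOp]
  -- Commutation of u with b is not available, so only its values on the e_j are kept and extended
  -- ℂ[[b]]-linearly. Compatibility with a then reduces to the relations on the e_j.
  let Φ : Xi lam N →+ ChangeVar θ (Xi lam N) := AddMonoidHom.mk'
    (fun v => ∑ i, Ahat.ofB (v i) • u (e lam N i)) (fun v w => by
      rw [← Finset.sum_add_distrib]
      refine Finset.sum_congr rfl fun i _ => ?_
      rw [← add_smul, ← map_add]
      rfl)
  have hΦ : ∀ v, Φ v = ∑ i, Ahat.ofB (v i) • u (e lam N i) := fun _ => rfl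
  have hB : ∀ S v, Φ (Ahat.ofB S • v) = Ahat.ofB S • Φ v := by
    intro S v
    rw [hΦ, hΦ, ofB_smul, Finset.smul_sum]
    refine Finset.sum_congr rfl fun i _ => ?_
    rw [map_mul, mul_smul]
  have he : ∀ j, Φ (e lam N j) = u (e lam N j) := by
    intro j
    rw [hΦ, Finset.sum_eq_single j]
    · rw [show e lam N j j = 1 from Pi.single_eq_same (M := fun _ => PowerSeries ℂ) j 1, map_one,
        one_smul]
    · intro i _ hij
      rw [show e lam N j i = 0 from Pi.single_eq_of_ne (M := fun _ => PowerSeries ℂ) hij 1,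
        map_zero, zero_smul]
    · simp
  -- Φ and u are only known to agree on basis vectors; the shift of e_j is either 0 or another basis
  -- vector.
  have hse : ∀ j, Φ (shift lam N (e lam N j)) = u (shift lam N (e lam N j)) := by
    intro j
    induction j using Fin.cases with
    | zero => rw [shift_e_zero, map_zero, map_zero]
    | succ j => rw [shift_e_succ, he]
  have ha : ∀ v, Φ (Ahat.a • v) = Ahat.a • Φ v := by
    intro v
    obtain ⟨S, rfl⟩ := (isBasisB lam N).exists_eq_sum v
    rw [Finset.smul_sum, map_sum, map_sum, Finset.smul_sum]
    refine Finset.sum_congr rfl fun j _ => ?_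
    rw [← mul_smul, hB, ← mul_smul, Ahat.a_mul_ofB, add_smul, add_smul, map_add, hB, mul_smul,
      mul_smul, hB, a_smul_e, he, hu, ← hse, ← he]
    congr 2
    rw [show Ahat.b = Ahat.ofB X from rfl, hB, map_add, Ahat.scalar, RingHom.comp_apply, hB]
  refine ⟨{ Φ with
    map_smul' := Ahat.map_smul_of_comm Φ exists_a_smul_eq ht.sep ha (hB X) fun c => hB (C c) }, ?_⟩
  refine (injective_iff_map_eq_zero Φ).2 fun v hv => ?_
  -- It suffices that the images of the e_j be independent modulo b, where β Ξ_λ ⊂ b Ξ_λ and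
  -- `twistOp` is the identity.
  refine ABModule.eq_zero_of_sum_ofB_smul (e := fun i => u (e lam N i)) ht.inj (fun c y hc => ?_) hv
  obtain ⟨y, rfl⟩ := t.toAddEquiv.surjective y
  have h1 : ∑ j, Ahat.scalar (c j) • twistOp g L (e lam N j) = θ.beta • y := by
    apply t.toAddEquiv.injective
    rw [t.map_beta_smul, ← hc, map_sum]
    exact Finset.sum_congr rfl fun j _ => t.map_scalar_smul _ _
  funext i
  have h2 := congrArg (ev lam N i) h1
  rw [ChangeOfVariable.beta, mul_smul, ev_b_smul, map_sum] at h2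
  simpa [ev_scalar_smul, ev_twistOp hg0 hL0, ev_e] using h2

end Xi

/-! ### Transport of themes, semi-simple frescos, S_1, Σ^1 and d -/

namespace Twist

open ABModule

universe u

variable {θ : ChangeOfVariable} {E E' : Type u} [AddCommGroup E] [Module Ahat E]
  [AddCommGroup E'] [Module Ahat E']

/-- The inverse of the pull-back of multivalued functions. -/
theorem exists_pushforward (θ : ChangeOfVariable) (lam : ℚ) (N : ℕ) :
    ∃ j : Xi lam N →+ Xi lam N, Function.Injective j ∧
      ∀ (x : Ahat) (v : Xi lam N), j (x • v) = θ.Theta x • j v := by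
  obtain ⟨φ, hφ⟩ := Xi.exists_pullback lam N θ
  exact ⟨(φ.toAddMonoidHom : Xi lam N →+ Xi lam N), hφ, fun x v => φ.map_smul x v⟩

/-- An embedding of E in Ξ_λ only embeds E' in θ_*(Ξ_λ). The pull-back by the inverse of θ returns
to Ξ_λ, the two changes of variable cancelling. -/
theorem isTheme (f : Twist θ E E') {lam : ℚ} (hE : IsTheme E lam) : IsTheme E' lam := by
  obtain ⟨h, N, φ, hφ⟩ := hE
  obtain ⟨j, hj, hj'⟩ := exists_pushforward θ.symm lam N
  refine ⟨f.isPrimitiveFresco h, N,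
    { toFun := fun x => j (φ (f.toAddEquiv.symm x))
      map_add' := fun x y => by simp only [map_add]
      map_smul' := fun x y => by
        rw [symm_smul, LinearMap.map_smul, hj', θ.Theta_symm_Theta, RingHom.id_apply] },
    hj.comp (hφ.comp f.toAddEquiv.symm.injective)⟩

/-- A map φ from E' to Ξ_λ, composed with the twist and the pull-back by θ, becomes an Â-linear map
ψ from E. The image of φ is a twist of the image of ψ, so both have the same rank. -/
theorem isSemisimpleFresco (f : Twist θ E E') {lam : ℚ} (hE : IsSemisimpleFresco E lam) :
    IsSemisimpleFresco E' lam := by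
  refine ⟨f.isPrimitiveFresco hE.1, fun N φ => ?_⟩
  obtain ⟨j, hj, hj'⟩ := exists_pushforward θ lam N
  let ψ : E →ₗ[Ahat] Xi lam N :=
    { toFun := fun x => j (φ (f.toAddEquiv x))
      map_add' := fun x y => by simp only [map_add]
      map_smul' := fun x y => by
        rw [f.map_smul, LinearMap.map_smul, hj', θ.Theta_Theta_symm, RingHom.id_apply] }
  have hmem : ∀ v : Xi lam N, v ∈ LinearMap.range φ → j v ∈ LinearMap.range ψ := by
    rintro _ ⟨x, rfl⟩
    exact ⟨f.toAddEquiv.symm x, congrArg (fun z => j (φ z)) (f.toAddEquiv.apply_symm_apply x)⟩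
  -- The pull-back j restricts to a bijection between the images; its inverse is the required twist.
  let k : LinearMap.range φ →+ LinearMap.range ψ := AddMonoidHom.mk'
    (fun v => ⟨j v, hmem v v.2⟩) fun v w => Subtype.ext (map_add j _ _)
  have hk : Function.Bijective k := by
    refine ⟨fun v w h => Subtype.ext (hj (congrArg Subtype.val h)), ?_⟩
    rintro ⟨_, x, rfl⟩
    exact ⟨⟨φ (f.toAddEquiv x), ⟨_, rfl⟩⟩, rfl⟩
  let κ := AddEquiv.ofBijective k hk
  have hκ : ∀ (x : Ahat) v, κ (x • v) = θ.Theta x • κ v := fun x v => Subtype.ext (hj' x v)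
  let t : Twist θ (LinearMap.range ψ) (LinearMap.range φ) :=
    { toAddEquiv := κ.symm
      map_Theta_smul' := fun x v => by
        change κ.symm (θ.Theta x • v) = x • κ.symm v
        rw [AddEquiv.symm_apply_eq, hκ, AddEquiv.apply_symm_apply] }
  obtain ⟨h1, h2⟩ := isFree_isFinite_of_injective (Xi.isBasisB lam N).isFree
    (Xi.isBasisB lam N).isFinite (LinearMap.range ψ).subtype Subtype.val_injective
  exact (t.isFree_isFinite_rank h1 h2).2.2.trans_le (hE.2 N ψ)

theorem isSemisimpleFresco_mapSubmodule_iff (f : Twist θ E E') {lam : ℚ}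
    {F : Submodule Ahat E} :
    IsSemisimpleFresco (f.mapSubmodule F) lam ↔ IsSemisimpleFresco F lam :=
  ⟨(f.restrict F).symm.isSemisimpleFresco, (f.restrict F).isSemisimpleFresco⟩

theorem isSemisimpleFresco_quotient_iff (f : Twist θ E E') {lam : ℚ}
    {F : Submodule Ahat E} :
    IsSemisimpleFresco (E' ⧸ f.mapSubmodule F) lam ↔ IsSemisimpleFresco (E ⧸ F) lam :=
  ⟨(f.quotient F).symm.isSemisimpleFresco, (f.quotient F).isSemisimpleFresco⟩

theorem isNormal_mapSubmodule_iff (f : Twist θ E E') (hE : IsFree E) (hE' : IsFinite E)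
    {F : Submodule Ahat E} : IsNormal (f.mapSubmodule F) ↔ IsNormal F := by
  refine ⟨fun h => ?_, f.isNormal hE'⟩
  have := f.symm.isNormal (f.isFree_isFinite_rank hE hE').2.1 h
  rwa [f.symm_mapSubmodule_mapSubmodule] at this

/-- An isomorphism of submodule lattices commutes with suprema, and it matches the semi-simple
submodules on both sides. -/
theorem mapSubmodule_S1 (f : Twist θ E E') (lam : ℚ) :
    f.mapSubmodule (S1 E lam) = S1 E' lam := by
  refine (f.submoduleOrderIso.map_sSup _).trans ?_
  rw [← sSup_image, S1]
  congr 1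
  ext F
  constructor
  · rintro ⟨G, hG, rfl⟩
    exact f.isSemisimpleFresco_mapSubmodule_iff.2 hG
  · intro hF
    exact ⟨f.symm.mapSubmodule F, f.symm.isSemisimpleFresco_mapSubmodule_iff.2 hF,
      f.mapSubmodule_symm_mapSubmodule F⟩

/-- Dually, the lattice isomorphism commutes with infima and matches the normal submodules with
semi-simple quotient. Finiteness enters through normality, whose transport goes through finite bases
of quotients. -/
theorem mapSubmodule_Sigma1 (f : Twist θ E E') (lam : ℚ) (hE : IsFree E) (hE' : IsFinite E) :
    f.mapSubmodule (Sigma1 E lam) = Sigma1 E' lam := by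
  refine (f.submoduleOrderIso.map_sInf _).trans ?_
  rw [← sInf_image, Sigma1]
  congr 1
  ext F
  constructor
  · rintro ⟨G, ⟨hG, hG'⟩, rfl⟩
    exact ⟨(f.isNormal_mapSubmodule_iff hE hE').2 hG, f.isSemisimpleFresco_quotient_iff.2 hG'⟩
  · rintro ⟨hF, hF'⟩
    obtain ⟨h1, h2, -⟩ := f.isFree_isFinite_rank hE hE'
    exact ⟨f.symm.mapSubmodule F, ⟨(f.symm.isNormal_mapSubmodule_iff h1 h2).2 hF,
      f.symm.isSemisimpleFresco_quotient_iff.2 hF'⟩, f.mapSubmodule_symm_mapSubmodule F⟩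

theorem exists_normal_theme (f : Twist θ E E') {lam : ℚ} (hE : IsFinite E) {r : ℕ}
    (h : ∃ F : Submodule Ahat E, IsNormal F ∧ IsTheme F lam ∧ rank F = r) :
    ∃ F : Submodule Ahat E', IsNormal F ∧ IsTheme F lam ∧ rank F = r := by
  obtain ⟨F, h1, h2, rfl⟩ := h
  obtain ⟨h3, h4⟩ := h2.1.1.1.1.isFree_isFinite
  exact ⟨f.mapSubmodule F, f.isNormal hE h1, (f.restrict F).isTheme h2,
    ((f.restrict F).isFree_isFinite_rank h3 h4).2.2⟩

theorem ssDepth_eq (f : Twist θ E E') (lam : ℚ) (hE : IsFree E) (hE' : IsFinite E) :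
    ssDepth E' lam = ssDepth E lam :=
  congrArg sSup (Set.ext fun _ => ⟨f.symm.exists_normal_theme (f.isFree_isFinite_rank hE hE').2.1,
    f.exists_normal_theme hE'⟩)

end Twist

end

/-! ### The theorem for θ_*(E) -/

theorem mainTheorem9 (lam : ℚ) (hlam0 : 0 < lam) (hlam1 : lam ≤ 1) (θ : ChangeOfVariable)
    (E : Type*) [AddCommGroup E] [Module Ahat E] :
    (ABModule.IsTheme E lam → ABModule.IsTheme (ChangeVar θ E) lam) ∧
    (ABModule.IsSemisimpleFresco E lam → ABModule.IsSemisimpleFresco (ChangeVar θ E) lam) ∧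
    (ABModule.IsPrimitiveFresco E lam →
      ABModule.IsPrimitiveFresco (ChangeVar θ E) lam ∧
      (∃ u : ChangeVar θ (ABModule.S1 E lam) ≃ₗ[Ahat] ABModule.S1 (ChangeVar θ E) lam,
        ∀ x : ABModule.S1 E lam,
          (u (ChangeVar.of θ _ x) : ChangeVar θ E) = ChangeVar.of θ E (x : E)) ∧
      (∃ v : ABModule.Sigma1 (ChangeVar θ E) lam ≃ₗ[Ahat] ChangeVar θ (ABModule.Sigma1 E lam),
        ∀ y : ABModule.Sigma1 (ChangeVar θ E) lam,
          ChangeVar.of θ E (((ChangeVar.of θ (ABModule.Sigma1 E lam)).symm (v y) :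
            ABModule.Sigma1 E lam) : E) = (y : ChangeVar θ E)) ∧
      ABModule.ssDepth (ChangeVar θ E) lam = ABModule.ssDepth E lam ∧
      ABModule.delta (ChangeVar θ E) lam = ABModule.delta E lam) := by
  let f := ChangeVar.twist θ E
  refine ⟨f.isTheme, f.isSemisimpleFresco, fun hE => ?_⟩
  obtain ⟨h1, h2⟩ := hE.1.1.1.isFree_isFinite
  -- The restricted twist is Â-linear once its source is viewed as θ_*(F). This gives u for F =
  -- S_1(E), and v as the inverse for F = Σ^1(E).
  have key : ∀ F : Submodule Ahat E, ∃ u : ChangeVar θ F ≃ₗ[Ahat] f.mapSubmodule F,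
      ∀ x : F, (u (ChangeVar.of θ _ x) : ChangeVar θ E) = ChangeVar.of θ E (x : E) := fun F =>
    ⟨{ (f.restrict F).toAddEquiv with
      map_smul' := fun x y => (f.restrict F).map_Theta_smul x y }, fun _ => rfl⟩
  refine ⟨f.isPrimitiveFresco hE, ?_, ?_, f.ssDepth_eq lam h1 h2, f.delta_eq lam⟩
  · rw [← f.mapSubmodule_S1]
    exact key _
  · rw [← f.mapSubmodule_Sigma1 lam h1 h2]
    obtain ⟨u, hu⟩ := key (ABModule.Sigma1 E lam)
    refine ⟨u.symm, fun y => ?_⟩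
    rw [← hu, AddEquiv.apply_symm_apply, LinearEquiv.apply_symm_apply]
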